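/- Let $M$ be a smooth $n$-manifold with $n\ge 2$. A \emph{special connection} on $M$ is a smooth torsion-free affine connection $\nabla_a$ together with a volume form $\epsilon$ (a nowhere vanishing smooth $n$-form) such that $\nabla_a\epsilon=0$. Fix a special connection and let $\mathcal S$ be the set of special connections $(\hat\nabla,\hat\epsilon)$ that are projectively equivalent to it, i.e. $\hat\nabla_aX^b=\nabla_aX^b+\Upsilon_aX^b+\delta_a{}^b\Upsilon_cX^c$ for a smooth 1-form $\Upsilon_a$, and that define the same orientation, i.e. $\hat\epsilon=e^{(n+1)f}\epsilon$ for a smooth function $f$ (in which case $\Upsilon_a=\nabla_af$). For a member of $\mathcal S$ define the Schouten tensor $\mathrm P_{ab}$ by $(\nabla_b\nabla_a-\nabla_a\nabla_b)X^b=(n-1)\mathrm P_{ab}X^b$, the projective Weyl tensor $W_{ab}{}^c{}_d$ by $$(\nabla_a\nabla_b-\nabla_b\nabla_a)X^c=W_{ab}{}^c{}_dX^d+\delta_a{}^c\mathrm P_{bd}X^d-\delta_b{}^c\mathrm P_{ad}X^d,$$ and the Cotton--York tensor $Y_{abc}=\tfrac12(\nabla_a\mathrm P_{bc}-\nabla_b\mathrm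 P_{ac})$. A smooth section of the tractor bundle $\mathcal E^{(BC)}$ (induced by $\bigodot^2\mathbb R^{n+1}$, with composition series $\mathcal E^{(bc)}(-2)+\mathcal E^b(-2)+\mathcal E(-2)$) assigns to each member of $\mathcal S$ a triple $(\sigma^{bc},\mu^b,\rho)$ consisting of a smooth symmetric contravariant $2$-tensor, a smooth vector field and a smooth function, such that whenever two members of $\mathcal S$ have volume forms related by $\hat\epsilon=e^{(n+1)f}\epsilon$, and $\Upsilon_a=\nabla_af$, $$(\hat\sigma^{bc},\hat\mu^b,\hat\rho)=e^{-2f}\bigl(\sigma^{bc},\ \mu^b+\Upsilon_c\sigma^{bc},\ \rho+2\Upsilon_b\mu^b+\Upsilon_b\Upsilon_c\sigma^{bc}\bigr).\qquad(*)$$ The tractor connection is $$\nabla_a\begin{pmatrix}\sigma^{bc}\\ \mu^b\\ \rho\end{pmatrix}=\begin{pmatrix}\nabla_a\sigma^{bc}-\delta_a{}^b\mu^c-\delta_a{}^c\mu^b\\ \nabla_a\mu^b-\delta_a{}^b\rho+\mathrm P_{ac}\sigma^{bc}\\ \nabla_a\rho+2\mathrm P_{ab}\mu^b\end{pmatrix}.$$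 \textbf{Theorem.} (i) For every section of $\mathcal E^{(BC)}$, its tractor derivative and the term $(0,\ W_{ac}{}^b{}_d\sigma^{cd},\ 4Y_{abc}\sigma^{bc})$, computed from the members of $\mathcal S$, both transform according to $(*)$; that is, both are projectively invariant. (ii) For every member $\nabla_a$ of $\mathcal S$, taking the component $\sigma^{bc}$ relative to $\nabla_a$ is a bijection from the set of smooth sections of $\mathcal E^{(BC)}$ that satisfy (relative to every member of $\mathcal S$) $$\nabla_a\begin{pmatrix}\sigma^{bc}\\ \mu^b\\ \rho\end{pmatrix}-\frac1n\begin{pmatrix}0\\ W_{ac}{}^b{}_d\sigma^{cd}\\ 4Y_{abc}\sigma^{bc}\end{pmatrix}=0$$ onto the set of smooth symmetric tensors $\sigma^{bc}$ that satisfy $$\nabla_a\sigma^{bc}=\delta_a{}^b\mu^c+\delta_a{}^c\mu^b\quad\text{for some smooth vector field }\mu^a.$$ -/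

import Mathlib

open Bundle FiberBundle Module
open scoped Manifold ContDiff Topology

noncomputable section

namespace ProjTractor

/-! ### Induced connections on trivial and Hom bundles -/

section General

variable {E : Type*} [NormedAddCommGroup E] [NormedSpace ℝ E]
  {H : Type*} [TopologicalSpace H] {I : ModelWithCorners ℝ E H}
  {M : Type*} [TopologicalSpace M] [ChartedSpace H M]

variable (I M) in
/-- The exterior derivative on functions, as the trivial connection on the trivial line bundle. -/
def trivialConn : CovariantDerivative I ℝ (Bundle.Trivial M ℝ) where
  toFun f x := mvfderiv I (fun y => (f y : ℝ)) x
  isCovariantDerivativeOnUniv :=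
    { add := by
        intro σ σ' x hσ hσ' _
        rw [mdifferentiableAt_section] at hσ hσ'
        exact mvfderiv_add hσ hσ'
      leibniz := by
        intro σ g x hσ hg _
        rw [mdifferentiableAt_section] at hσ
        exact mvfderiv_smul hg hσ }

variable
  {F₁ : Type*} [NormedAddCommGroup F₁] [NormedSpace ℝ F₁]
  {V₁ : M → Type*} [TopologicalSpace (TotalSpace F₁ V₁)]
  [∀ x, AddCommGroup (V₁ x)] [∀ x, Module ℝ (V₁ x)] [∀ x, TopologicalSpace (V₁ x)]
  [∀ x, IsTopologicalAddGroup (V₁ x)] [∀ x, ContinuousSMul ℝ (V₁ x)]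
  [FiberBundle F₁ V₁] [VectorBundle ℝ F₁ V₁]
  {F₂ : Type*} [NormedAddCommGroup F₂] [NormedSpace ℝ F₂]
  {V₂ : M → Type*} [TopologicalSpace (TotalSpace F₂ V₂)]
  [∀ x, AddCommGroup (V₂ x)] [∀ x, Module ℝ (V₂ x)] [∀ x, TopologicalSpace (V₂ x)]
  [∀ x, IsTopologicalAddGroup (V₂ x)] [∀ x, ContinuousSMul ℝ (V₂ x)]
  [FiberBundle F₂ V₂] [VectorBundle ℝ F₂ V₂]

theorem homDeriv_tensorial (D₁ : CovariantDerivative I F₁ V₁) (D₂ : CovariantDerivative I F₂ V₂)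
    {A : Π x : M, V₁ x →L[ℝ] V₂ x} {x : M}
    (hA : MDifferentiableAt I (I.prod 𝓘(ℝ, F₁ →L[ℝ] F₂))
      (fun y => TotalSpace.mk' (F₁ →L[ℝ] F₂) (E := fun y => V₁ y →L[ℝ] V₂ y) y (A y)) x)
    (v : TangentSpace I x) :
    TensorialAt I F₁ (fun s : Π y, V₁ y => D₂ (fun y => A y (s y)) x v - A x (D₁ s x v)) x where
  smul := by
    intro f s hf hs
    have h := D₂.isCovariantDerivativeOnUniv.leibniz (hA.clm_bundle_apply hs) hf
    have h1 := D₁.isCovariantDerivativeOnUniv.leibniz hs hf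
    have e : (fun y => A y ((f • s) y)) = f • (fun y => A y (s y)) := by
      ext y; simp
    rw [e, h, h1]
    simp
    module
  add := by
    intro s s' hs hs'
    have h := D₂.isCovariantDerivativeOnUniv.add (hA.clm_bundle_apply hs) (hA.clm_bundle_apply hs')
    have h1 := D₁.isCovariantDerivativeOnUniv.add hs hs'
    have e : (fun y => A y ((s + s') y)) = (fun y => A y (s y)) + (fun y => A y (s' y)) := by
      ext y; simp
    rw [e, h, h1]
    simp
    module

variable [FiniteDimensional ℝ E] [FiniteDimensional ℝ F₁] [ContMDiffVectorBundle 1 F₁ V₁ I]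

open Classical in
/-- The covariant derivative of a section `A` of `Hom(V₁, V₂)`, given by the Leibniz rule
`(∇_v A)(s) = ∇_v (A s) - A (∇_v s)` (see `homDeriv_apply`). As always for `CovariantDerivative`,
only the values on differentiable sections are meaningful. -/
def homDeriv (D₁ : CovariantDerivative I F₁ V₁) (D₂ : CovariantDerivative I F₂ V₂)
    (A : Π x : M, V₁ x →L[ℝ] V₂ x) (x : M) : TangentSpace I x →L[ℝ] V₁ x →L[ℝ] V₂ x :=
  haveI : FiniteDimensional ℝ (TangentSpace I x) := inferInstanceAs (FiniteDimensional ℝ E)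
  haveI : T2Space (TangentSpace I x) := inferInstanceAs (T2Space E)
  if hA : MDifferentiableAt I (I.prod 𝓘(ℝ, F₁ →L[ℝ] F₂))
    (fun y => TotalSpace.mk' (F₁ →L[ℝ] F₂) (E := fun y => V₁ y →L[ℝ] V₂ y) y (A y)) x then
    LinearMap.toContinuousLinearMap
      { toFun v := TensorialAt.mkHom _ x (homDeriv_tensorial D₁ D₂ hA v)
        map_add' v w := by
          ext s
          simp only [TensorialAt.mkHom_apply_eq_extend, add_apply, map_add]
          abel
        map_smul' c v := by
          ext s
          simp only [TensorialAt.mkHom_apply_eq_extend, smul_apply, map_smul,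
            smul_sub, RingHom.id_apply] }
  else 0

theorem homDeriv_apply (D₁ : CovariantDerivative I F₁ V₁) (D₂ : CovariantDerivative I F₂ V₂)
    {A : Π x : M, V₁ x →L[ℝ] V₂ x} {x : M}
    (hA : MDifferentiableAt I (I.prod 𝓘(ℝ, F₁ →L[ℝ] F₂))
      (fun y => TotalSpace.mk' (F₁ →L[ℝ] F₂) (E := fun y => V₁ y →L[ℝ] V₂ y) y (A y)) x)
    {s : Π y, V₁ y} (hs : MDifferentiableAt I (I.prod 𝓘(ℝ, F₁))
      (fun y => TotalSpace.mk' F₁ y (s y)) x) (v : TangentSpace I x) :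
    homDeriv D₁ D₂ A x v (s x) = D₂ (fun y => A y (s y)) x v - A x (D₁ s x v) := by
  have : homDeriv D₁ D₂ A x v = TensorialAt.mkHom _ x (homDeriv_tensorial D₁ D₂ hA v) := by
    simp only [homDeriv]
    rw [dif_pos hA]
    rfl
  rw [this, TensorialAt.mkHom_apply _ hs]

/-- The connection induced on `Hom(V₁, V₂)` by connections on `V₁` and `V₂`. -/
def homConn (D₁ : CovariantDerivative I F₁ V₁) (D₂ : CovariantDerivative I F₂ V₂) :
    CovariantDerivative I (F₁ →L[ℝ] F₂) (fun y => V₁ y →L[ℝ] V₂ y) where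
  toFun := homDeriv D₁ D₂
  isCovariantDerivativeOnUniv :=
    { add := by
        intro A A' x hA hA' _
        ext v s
        have hs := mdifferentiableAt_extend I F₁ s
        have h := D₂.isCovariantDerivativeOnUniv.add (hA.clm_bundle_apply hs)
          (hA'.clm_bundle_apply hs)
        have e : (fun y => (A + A') y (extend F₁ s y)) =
          (fun y => A y (extend F₁ s y)) + (fun y => A' y (extend F₁ s y)) := by
          ext y; simp
        have h1 := homDeriv_apply D₁ D₂ hA hs v
        have h2 := homDeriv_apply D₁ D₂ hA' hs v
        have h3 := homDeriv_apply D₁ D₂ (mdifferentiableAt_add_section hA hA') hs v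
        rw [e, h] at h3
        simp only [extend_apply_self, Pi.add_apply, add_apply] at h1 h2 h3 ⊢
        rw [h1, h2, h3]
        abel
      leibniz := by
        intro A g x hA hg _
        ext v s
        have hs := mdifferentiableAt_extend I F₁ s
        have h := D₂.isCovariantDerivativeOnUniv.leibniz (hA.clm_bundle_apply hs) hg
        have e : (fun y => (g • A) y (extend F₁ s y)) =
          g • (fun y => A y (extend F₁ s y)) := by
          ext y; simp
        have h1 := homDeriv_apply D₁ D₂ hA hs v
        have h3 := homDeriv_apply D₁ D₂ (hg.smul_section hA) hs v
        rw [e, h] at h3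
        simp only [extend_apply_self, Pi.smul_apply', add_apply, smul_apply,
          ContinuousLinearMap.smulRight_apply] at h1 h3 ⊢
        rw [h1, h3]
        module }

end General

/-- A smooth connection maps sections that are smooth near a point to sections that are smooth at
that point. -/
theorem contMDiffAt_conn {E : Type*} [NormedAddCommGroup E] [NormedSpace ℝ E]
    [FiniteDimensional ℝ E]
    {H : Type*} [TopologicalSpace H] {I : ModelWithCorners ℝ E H}
    {M : Type*} [TopologicalSpace M] [ChartedSpace H M] [T2Space M] [IsManifold I ∞ M]
    {F : Type*} [NormedAddCommGroup F] [NormedSpace ℝ F]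
    {V : M → Type*} [TopologicalSpace (TotalSpace F V)]
    [∀ x, AddCommGroup (V x)] [∀ x, Module ℝ (V x)] [∀ x, TopologicalSpace (V x)]
    [∀ x, IsTopologicalAddGroup (V x)] [∀ x, ContinuousSMul ℝ (V x)]
    [FiberBundle F V] [VectorBundle ℝ F V]
    (D : CovariantDerivative I F V) [hD : CovariantDerivative.ContMDiffCovariantDerivative D ∞]
    {s : Π x, V x} {x : M} {u : Set M} (hu : u ∈ 𝓝 x)
    (hs : ContMDiffOn I (I.prod 𝓘(ℝ, F)) ∞ (fun y => TotalSpace.mk' F y (s y)) u) :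
    ContMDiffAt I (I.prod 𝓘(ℝ, E →L[ℝ] F)) ∞
      (fun y => TotalSpace.mk' (E →L[ℝ] F) (E := fun y => TangentSpace I y →L[ℝ] V y)
        y (D s y)) x := by
  obtain ⟨ψ, -, hψ⟩ := (SmoothBumpFunction.nhds_basis_tsupport (I := I) x).mem_iff.1
    (interior_mem_nhds.2 hu)
  have hψs : ContMDiff I (I.prod 𝓘(ℝ, F)) ∞
      (fun y => TotalSpace.mk' F y (((ψ : M → ℝ) • s) y)) :=
    ContMDiffOn.smul_section_of_tsupport (u := interior u) ψ.contMDiff.contMDiffOn isOpen_interior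
      hψ (hs.mono interior_subset)
  have h := hD.contMDiff.contMDiff (σ := (ψ : M → ℝ) • s) (by simpa using hψs.contMDiffOn)
  have h := h.contMDiffAt (x := x) Filter.univ_mem
  refine h.congr_of_eventuallyEq ?_
  filter_upwards [ψ.eventuallyEq_one.eventuallyEq_nhds, interior_mem_nhds.2 hu] with y hy hyu
  have hsy : MDifferentiableAt I (I.prod 𝓘(ℝ, F)) (fun y => TotalSpace.mk' F y (s y)) y :=
    (hs.contMDiffAt (mem_interior_iff_mem_nhds.1 hyu)).mdifferentiableAt (by simp)
  have : D s y = D ((ψ : M → ℝ) • s) y := by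
    refine D.isCovariantDerivativeOnUniv.congr_of_eventuallyEq hsy
      (hψs.contMDiffAt.mdifferentiableAt (by simp)) Filter.univ_mem ?_
    filter_upwards [hy] with z hz
    simp [hz]
  simp [this]

/-! ### Tensors on a smooth `n`-manifold `M` without boundary -/

section Tensors

variable (n : ℕ) {M : Type*} [TopologicalSpace M] [ChartedSpace (EuclideanSpace ℝ (Fin n)) M]

/-- The tangent space of `M` at `x`. -/
abbrev Tan (x : M) : Type := TangentSpace (𝓡 n) x

/-- The cotangent space of `M` at `x`. -/
abbrev Cot (x : M) : Type := TangentSpace (𝓡 n) x →L[ℝ] Bundle.Trivial M ℝ x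

/-- The fibre at `x` of `TM ⊗ TM`: a tensor `σ^{bc}` is the map `α_c ↦ σ^{bc} α_c` from covectors
to vectors. -/
abbrev Biv (x : M) : Type := Cot n x →L[ℝ] TangentSpace (𝓡 n) x

variable (M) [IsManifold (𝓡 n) ∞ M]

/-- Smooth vector fields. -/
abbrev VField : Type _ :=
  ContMDiffSection (𝓡 n) (EuclideanSpace ℝ (Fin n)) ∞ (Tan n : M → Type)

/-- Smooth 1-forms. -/
abbrev OneForm : Type _ :=
  ContMDiffSection (𝓡 n) (EuclideanSpace ℝ (Fin n) →L[ℝ] ℝ) ∞ (Cot n : M → Type)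

/-- Smooth contravariant 2-tensors. -/
abbrev BivField : Type _ :=
  ContMDiffSection (𝓡 n) ((EuclideanSpace ℝ (Fin n) →L[ℝ] ℝ) →L[ℝ] EuclideanSpace ℝ (Fin n)) ∞
    (Biv n : M → Type)

/-- Affine connections: connections on the tangent bundle. -/
abbrev AffConn : Type _ :=
  CovariantDerivative (𝓡 n) (EuclideanSpace ℝ (Fin n)) (Tan n : M → Type)

variable {n M}

/-- The differential of a function, as a covector. -/
def differential (f : M → ℝ) (x : M) : Cot n x := mvfderiv (𝓡 n) f x

/-- The symmetry condition `σ^{bc} = σ^{cb}`. -/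
def BivField.IsSymm (σ : BivField n M) : Prop :=
  ∀ (x : M) (α β : Cot n x), β (σ x α) = α (σ x β)

instance (x : M) : FiniteDimensional ℝ (Tan n x) :=
  inferInstanceAs (FiniteDimensional ℝ (EuclideanSpace ℝ (Fin n)))

instance (x : M) : T2Space (Tan n x) :=
  inferInstanceAs (T2Space (EuclideanSpace ℝ (Fin n)))

/-- A basis `e_i` of the tangent space at `x`, used to write contractions of tensors; these do not
depend on the choice. -/
def frame (x : M) : Basis (Fin n) ℝ (Tan n x) := (EuclideanSpace.basisFun (Fin n) ℝ).toBasis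

/-- The dual basis `e^i` of the cotangent space. -/
def coframe (x : M) (i : Fin n) : Cot n x := LinearMap.toContinuousLinearMap ((frame x).coord i)

/-- The symmetric tensor `v^b w^c + w^b v^c`. -/
def symProd {x : M} (v w : Tan n x) : Biv n x :=
  LinearMap.toContinuousLinearMap
    { toFun α := (α w : ℝ) • v + (α v : ℝ) • w
      map_add' α β := by
        simp only [add_apply, add_smul]
        abel
      map_smul' c α := by
        simp only [smul_apply, smul_eq_mul, mul_smul, smul_add, RingHom.id_apply] }

end Tensors

section Curvature

variable {n : ℕ} {M : Type*} [TopologicalSpace M] [ChartedSpace (EuclideanSpace ℝ (Fin n)) M]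
  [IsManifold (𝓡 n) ∞ M]

/-- The connection on 1-forms dual to an affine connection. -/
def dualConn (D : AffConn n M) :
    CovariantDerivative (𝓡 n) (EuclideanSpace ℝ (Fin n) →L[ℝ] ℝ) (Cot n : M → Type) :=
  homConn D (trivialConn (𝓡 n) M)

/-- The induced covariant derivative of contravariant 2-tensors: `bivDeriv D σ x v` is
`v^a ∇_a σ^{bc}`. -/
def bivDeriv (D : AffConn n M) (σ : Π x : M, Biv n x) (x : M) : Tan n x →L[ℝ] Biv n x :=
  homConn (dualConn D) D σ x

/-- The second covariant derivative of a vector field: `secondDeriv D X x u v` is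
`u^a v^b ∇_a ∇_b X^c`. -/
def secondDeriv (D : AffConn n M) (X : Π x : M, Tan n x) (x : M) :
    Tan n x →L[ℝ] Tan n x →L[ℝ] Tan n x :=
  homConn D D (D X) x

/-- The curvature: `curv D x u v w` is `u^a v^b (∇_a ∇_b - ∇_b ∇_a) X^c`, where `X` is a vector
field, smooth near `x`, with `X(x) = w`. -/
def curv (D : AffConn n M) (x : M) (u v w : Tan n x) : Tan n x :=
  secondDeriv D (extend (EuclideanSpace ℝ (Fin n)) w) x u v -
    secondDeriv D (extend (EuclideanSpace ℝ (Fin n)) w) x v u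

theorem extend_linear {x : M} (c : ℝ) (w w' : Tan n x) :
    ∀ᶠ y in 𝓝 x, extend (EuclideanSpace ℝ (Fin n)) (c • w + w') y =
      c • extend (EuclideanSpace ℝ (Fin n)) w y +
        (extend (EuclideanSpace ℝ (Fin n)) w' y : Tan n y) := by
  let t := trivializationAt (EuclideanSpace ℝ (Fin n)) (Tan n : M → Type) x
  have hx : x ∈ t.baseSet := mem_baseSet_trivializationAt' x
  filter_upwards [t.open_baseSet.mem_nhds hx] with y hy
  have h (w : Tan n x) : extend (EuclideanSpace ℝ (Fin n)) w y =
      t.symmₗ ℝ y (t.linearMapAt ℝ x w) := by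
    rw [t.coe_linearMapAt_of_mem hx, t.coe_symmₗ hy]
    rfl
  simp only [h, map_add, map_smul]

theorem secondDeriv_extend_linear [T2Space M] (D : AffConn n M)
    [CovariantDerivative.ContMDiffCovariantDerivative D ∞] {x : M} (c : ℝ) (w w' : Tan n x) :
    secondDeriv D (extend (EuclideanSpace ℝ (Fin n)) (c • w + w')) x =
      c • secondDeriv D (extend (EuclideanSpace ℝ (Fin n)) w) x +
        secondDeriv D (extend (EuclideanSpace ℝ (Fin n)) w') x := by
  have hsm (w : Tan n x) :
      ∀ᶠ y in 𝓝 x, MDifferentiableAt (𝓡 n) ((𝓡 n).prod 𝓘(ℝ, EuclideanSpace ℝ (Fin n)))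
        (fun y => TotalSpace.mk' (EuclideanSpace ℝ (Fin n)) y
          (extend (EuclideanSpace ℝ (Fin n)) w y : Tan n y)) y := by
    obtain ⟨u, hu, hs⟩ := exists_contMDiffOn_extend (k := ∞) (𝓡 n) (EuclideanSpace ℝ (Fin n)) w
    filter_upwards [eventually_mem_nhds_iff.2 hu] with y hy
    exact (hs.contMDiffAt hy).mdifferentiableAt (by simp)
  have hD (w : Tan n x) := (contMDiffAt_conn D
    (exists_contMDiffOn_extend (k := ∞) (𝓡 n) (EuclideanSpace ℝ (Fin n)) w).choose_spec.1
    (exists_contMDiffOn_extend (k := ∞) (𝓡 n) (EuclideanSpace ℝ (Fin n)) w).choose_spec.2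
    ).mdifferentiableAt (by simp)
  have hc := (mdifferentiableAt_const (I := 𝓡 n) (c := c) (x := x)).smul_section (hD w)
  have h1 := (homConn D D).isCovariantDerivativeOnUniv.add hc (hD w')
  have h2 := (homConn D D).isCovariantDerivativeOnUniv.smul_const c (hD w)
  rw [secondDeriv, secondDeriv, secondDeriv, ← h2]
  refine Eq.trans ?_ h1
  refine (homConn D D).isCovariantDerivativeOnUniv.congr_of_eventuallyEq (hD _)
    (mdifferentiableAt_add_section hc (hD w')) Filter.univ_mem ?_
  filter_upwards [hsm w, hsm w', hsm (c • w + w'),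
    eventually_eventually_nhds.2 (extend_linear c w w')] with y hy hy' hy'' he
  have hc' := (mdifferentiableAt_const (I := 𝓡 n) (c := c) (x := y)).smul_section hy
  rw [D.isCovariantDerivativeOnUniv.congr_of_eventuallyEq hy''
    (mdifferentiableAt_add_section hc' hy') Filter.univ_mem he]
  refine (D.isCovariantDerivativeOnUniv.add hc' hy').trans ?_
  exact congrArg (· + _) (D.isCovariantDerivativeOnUniv.smul_const c hy)

theorem curv_linear [T2Space M] (D : AffConn n M)
    [CovariantDerivative.ContMDiffCovariantDerivative D ∞] {x : M} (u v : Tan n x) (c : ℝ)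
    (w w' : Tan n x) : curv D x u v (c • w + w') = c • curv D x u v w + curv D x u v w' := by
  simp only [curv, secondDeriv_extend_linear, add_apply, smul_apply, smul_sub]
  abel

/-- The Ricci tensor `R_{ab}`, normalised by `(∇_b ∇_a - ∇_a ∇_b) X^b = R_{ab} X^b`:
`ricci D x u w` is `u^a w^b R_{ab}`. -/
def ricci (D : AffConn n M) (x : M) (u w : Tan n x) : ℝ :=
  ∑ i, coframe x i (curv D x (frame x i) u w)

/-- The projective Schouten tensor `P_{ab} = R_{ab} / (n - 1)`, as the bilinear form
`schouten D x u w = u^a w^b P_{ab}`. -/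
def schouten [T2Space M] (D : AffConn n M)
    [CovariantDerivative.ContMDiffCovariantDerivative D ∞] (x : M) : Tan n x →L[ℝ] Cot n x :=
  LinearMap.toContinuousBilinearMap
    (LinearMap.mk₂ ℝ (fun u w : Tan n x => ((n : ℝ) - 1)⁻¹ * ricci D x u w)
      (by
        intro u u' w
        simp only [ricci, curv, map_add, add_apply, map_sub, Finset.sum_add_distrib,
          Finset.sum_sub_distrib]
        ring)
      (by
        intro c u w
        simp only [ricci, curv, map_smul, smul_apply, map_sub, smul_eq_mul, ← mul_sub,
          ← Finset.mul_sum]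
        ring)
      (by
        intro u w w'
        have h (i : Fin n) := curv_linear D (frame x i) u 1 w w'
        simp only [one_smul] at h
        simp only [ricci, h, map_add, Finset.sum_add_distrib]
        ring)
      (by
        intro c u w
        have h0 (i : Fin n) : curv D x (frame x i) u 0 = 0 := by
          simpa using curv_linear D (frame x i) u 1 0 0
        have h (i : Fin n) : curv D x (frame x i) u (c • w) = c • curv D x (frame x i) u w := by
          simpa [h0] using curv_linear D (frame x i) u c w 0
        simp only [ricci, h, map_smul, smul_eq_mul, ← Finset.mul_sum]
        ring))

variable [T2Space M] (D : AffConn n M) [CovariantDerivative.ContMDiffCovariantDerivative D ∞]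

/-- The projective Weyl tensor: `weyl D x u v w` is `u^a v^b W_{ab}{}^c{}_d w^d`, where
`R_{ab}{}^c{}_d = W_{ab}{}^c{}_d + δ_a{}^c P_{bd} - δ_b{}^c P_{ad}`. -/
def weyl (x : M) (u v w : Tan n x) : Tan n x :=
  curv D x u v w - (schouten D x v w : ℝ) • u + (schouten D x u w : ℝ) • v

/-- The covariant derivative of the Schouten tensor: `schoutenDeriv D x u v w` is
`u^a v^b w^c ∇_a P_{bc}`. -/
def schoutenDeriv (x : M) : Tan n x →L[ℝ] Tan n x →L[ℝ] Cot n x :=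
  homConn D (dualConn D) (schouten D) x

/-- The Cotton-York tensor `Y_{abc} = (∇_a P_{bc} - ∇_b P_{ac}) / 2`: `cotton D x u v w` is
`u^a v^b w^c Y_{abc}`. -/
def cotton (x : M) (u v w : Tan n x) : ℝ :=
  (1 / 2) * ((schoutenDeriv D x u v w : ℝ) - (schoutenDeriv D x v u w : ℝ))

end Curvature

/-! ### Special connections, projective changes and tractors -/

section Tractors

variable (n : ℕ) (M : Type*) [TopologicalSpace M] [ChartedSpace (EuclideanSpace ℝ (Fin n)) M]
  [IsManifold (𝓡 n) ∞ M]

/-- A smooth torsion-free affine connection `∇` together with a volume form `ε`, i.e. a nowhere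
vanishing smooth `n`-form, such that `∇ ε = 0`. -/
structure SpecialConnection where
  conn : AffConn n M
  smooth : CovariantDerivative.ContMDiffCovariantDerivative conn ∞
  torsionFree : conn.torsion = 0
  vol : Π x : M, (Tan n x) [⋀^Fin n]→ₗ[ℝ] ℝ
  vol_smooth : ∀ X : Fin n → VField n M,
    ContMDiff (𝓡 n) 𝓘(ℝ, ℝ) ∞ (fun x => vol x (fun i => X i x))
  vol_ne_zero : ∀ x, vol x ≠ 0
  vol_parallel : ∀ (X : Fin n → VField n M) (x : M) (v : Tan n x),
    mvfderiv (𝓡 n) (fun y => vol y (fun i => X i y)) x v =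
      ∑ i, vol x (Function.update (fun j => X j x) i (conn (X i) x v))

attribute [instance] SpecialConnection.smooth

variable {n M}

/-- Projective equivalence: `∇'_a X^b = ∇_a X^b + Υ_a X^b + δ_a{}^b Υ_c X^c` for some smooth
1-form `Υ`. -/
def ProjEquiv (D D' : AffConn n M) : Prop :=
  ∃ Υ : OneForm n M, ∀ (X : Π x : M, Tan n x) (x : M),
    MDifferentiableAt (𝓡 n) ((𝓡 n).prod 𝓘(ℝ, EuclideanSpace ℝ (Fin n)))
      (fun y => TotalSpace.mk' (EuclideanSpace ℝ (Fin n)) y (X y)) x →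
    ∀ v : Tan n x, D' X x v = D X x v + (Υ x v : ℝ) • X x + (Υ x (X x) : ℝ) • v

/-- The volume forms are related by `ε' = e^{(n+1)f} ε`. -/
def VolRescaling (D D' : SpecialConnection n M) (f : C^∞⟮𝓡 n, M; ℝ⟯) : Prop :=
  ∀ x, D'.vol x = Real.exp ((n + 1) * f x) • D.vol x

/-- The special connections `(∇', ε')` in the projective class of `(∇, ε)`, with `ε'` inducing the
same orientation as `ε`. -/
def Scale (D : SpecialConnection n M) : Type _ :=
  {D' : SpecialConnection n M // ProjEquiv D.conn D'.conn ∧ ∃ f, VolRescaling D D' f}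

variable (n M) in
/-- A smooth section `(σ^{bc}, μ^b, ρ)` of `⊙²TM ⊕ TM ⊕ ℝ`. -/
structure Triple where
  sigma : BivField n M
  symm : sigma.IsSymm
  mu : VField n M
  rho : C^∞⟮𝓡 n, M; ℝ⟯

variable (n) in
/-- The sum of fibres at `x` of `TM ⊗ TM`, `TM` and `ℝ`. -/
abbrev Slots (x : M) : Type := Biv n x × Tan n x × ℝ

/-- The value of a triple at a point. -/
def Triple.eval (s : Triple n M) (x : M) : Slots n x := (s.sigma x, s.mu x, s.rho x)

/-- The change of splitting of the tractor bundle, whose constituents have projective weight `-2`,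
under `ε ↦ e^{(n+1)f} ε`, where `t = f(x)` and `Υ = df(x)`:
`(σ^{bc}, μ^b, ρ) ↦ e^{-2f} (σ^{bc}, μ^b + Υ_c σ^{bc}, ρ + 2 Υ_b μ^b + Υ_b Υ_c σ^{bc})`. -/
def changeSplitting {x : M} (t : ℝ) (Υ : Cot n x) (s : Slots n x) : Slots n x :=
  Real.exp (-2 * t) •
    ((s.1, s.2.1 + s.1 Υ, s.2.2 + 2 * (Υ s.2.1 : ℝ) + (Υ (s.1 Υ) : ℝ)) : Slots n x)

/-- Smooth sections of the tractor bundle `𝓔^{(BC)}` of the projective class of `D`: a triple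
`(σ^{bc}, μ^b, ρ)` for each scale, compatible with all changes of scale. -/
structure TractorSection (D : SpecialConnection n M) where
  comp : Scale D → Triple n M
  change : ∀ (D₁ D₂ : Scale D) (f : C^∞⟮𝓡 n, M; ℝ⟯), VolRescaling D₁.1 D₂.1 f →
    ∀ x, (comp D₂).eval x = changeSplitting (f x) (differential f x) ((comp D₁).eval x)

/-- The equation `∇_a σ^{bc} = δ_a{}^b μ^c + δ_a{}^c μ^b` for some smooth vector field `μ`. -/
def IsKeySolution (D : SpecialConnection n M) (σ : BivField n M) : Prop :=
  ∃ μ : VField n M, ∀ (x : M) (v : Tan n x), bivDeriv D.conn σ x v = symProd v (μ x)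

variable [T2Space M]

/-- The tractor connection in the splitting given by a special connection, in the direction `v`:
`(∇_a σ^{bc} - δ_a{}^b μ^c - δ_a{}^c μ^b, ∇_a μ^b - δ_a{}^b ρ + P_{ac} σ^{bc},
∇_a ρ + 2 P_{ab} μ^b)`. -/
def tractorDeriv (D : SpecialConnection n M) (s : Triple n M) (x : M) (v : Tan n x) : Slots n x :=
  (bivDeriv D.conn s.sigma x v - symProd v (s.mu x),
    D.conn s.mu x v - s.rho x • v + s.sigma x (schouten D.conn x v),
    (differential s.rho x v : ℝ) + 2 * (schouten D.conn x v (s.mu x) : ℝ))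

/-- The term `(0, W_{ac}{}^b{}_d σ^{cd}, 4 Y_{abc} σ^{bc})`, in the direction `v`. -/
def extraTerm (D : SpecialConnection n M) (σ : BivField n M) (x : M) (v : Tan n x) : Slots n x :=
  (0, ∑ i, weyl D.conn x v (frame x i) (σ x (coframe x i)),
    4 * ∑ i, cotton D.conn x v (frame x i) (σ x (coframe x i)))

end Tractors

end ProjTractor

end

/-!
Everything rests on computing at a point `x` with sections that are parallel at `x`: every vector
or covector at `x` extends to such a section (`exists_parallel_extension`). For torsion-free
connections the bracket `∇_U V - ∇_V U` is the Lie bracket, its Jacobi identity makes it the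
commutator of directional derivatives (`der_brk`), and curvature is the commutator of covariant
derivatives (`curv_apply`). From this follow the two Bianchi identities. The parallel volume form
makes the curvature endomorphisms trace-free (`trace_curv`), so that the Ricci and Schouten tensors
are symmetric.

*Invariance.* Two members of the class with `ε' = e^{(n+1)f} ε` differ by the projective change with
`Υ = df`: the derivative of a volume form in a parallel frame detects the trace of the difference
tensor (`isProjChange_of_volRescaling`). Then `P' = P - ∇Υ + Υ ⊗ Υ`, `W' = W` and
`Y'_{abc} = Y_{abc} + ½ Υ_d W_{ab}{}^d{}_c`, which give the invariance of the curvature term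
(`IsProjChange.extraTerm_eq`) and, slot by slot, that of the tractor connection
(`IsProjChange.tractorDeriv_eq`).

*Prolongation.* Let `∇_a σ^{bc} = δ_a^b μ^c + δ_a^c μ^b`. Contracting the Ricci identity for `σ`
determines the trace-free part of `∇μ` through the curvature and `σ` (`conn_mu_eq`), which is the
`μ` slot of the prolonged equation with `ρ = (∇_a μ^a + P_{ab} σ^{ab}) / n` (`conn_mu_sub_eq`).
Differentiating once more, antisymmetrising, and simplifying with both Bianchi identities gives
`curv_mu_eq`, whose trace determines the differential of `∇_a μ^a` (`mvfderiv_divergence`) and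
hence that of `ρ` (`mvfderiv_rhoOf`). Conversely the first two slots of the prolonged equation
recover `μ` and `ρ` from `σ` (`triple_eq_of_sigma_eq`). Since changes of splitting compose, a triple
in one scale extends uniquely to a tractor section (`TractorSection.ofTriple`,
`TractorSection.ext_comp`), and by invariance the prolonged equation need only be checked in that
scale.
-/

open Bundle FiberBundle Module
open scoped Manifold ContDiff Topology

noncomputable section

set_option linter.unusedSectionVars false

namespace ProjTractor

/-! ### Smooth sections with prescribed germs, and connections acting on them -/

section General

variable {E : Type*} [NormedAddCommGroup E] [NormedSpace ℝ E] [FiniteDimensional ℝ E]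
  {H : Type*} [TopologicalSpace H] {I : ModelWithCorners ℝ E H}
  {M : Type*} [TopologicalSpace M] [ChartedSpace H M] [T2Space M] [IsManifold I ∞ M]
  {F : Type*} [NormedAddCommGroup F] [NormedSpace ℝ F]
  {V : M → Type*} [TopologicalSpace (TotalSpace F V)]
  [∀ x, AddCommGroup (V x)] [∀ x, Module ℝ (V x)] [∀ x, TopologicalSpace (V x)]
  [∀ x, IsTopologicalAddGroup (V x)] [∀ x, ContinuousSMul ℝ (V x)]
  [FiberBundle F V] [VectorBundle ℝ F V]

/-- A section that is smooth near a point agrees near that point with a global smooth section. -/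
theorem exists_section_eventuallyEq {s : Π x, V x} {x : M} {u : Set M} (hu : u ∈ 𝓝 x)
    (hs : ContMDiffOn I (I.prod 𝓘(ℝ, F)) ∞ (fun y => TotalSpace.mk' F y (s y)) u) :
    ∃ S : ContMDiffSection I F ∞ V, ∀ᶠ y in 𝓝 x, S y = s y := by
  obtain ⟨ψ, -, hψ⟩ := (SmoothBumpFunction.nhds_basis_tsupport (I := I) x).mem_iff.1
    (interior_mem_nhds.2 hu)
  refine ⟨⟨(ψ : M → ℝ) • s, ContMDiffOn.smul_section_of_tsupport (u := interior u)
    ψ.contMDiff.contMDiffOn isOpen_interior hψ (hs.mono interior_subset)⟩, ?_⟩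
  filter_upwards [ψ.eventuallyEq_one] with y hy
  simp [hy]

theorem exists_section_extend [ContMDiffVectorBundle ∞ F V I] {x : M} (v : V x) :
    ∃ S : ContMDiffSection I F ∞ V, ∀ᶠ y in 𝓝 x, S y = extend F v y := by
  obtain ⟨u, hu, hs⟩ := exists_contMDiffOn_extend (k := ∞) I F v
  exact exists_section_eventuallyEq hu hs

theorem exists_function_eventuallyEq {f : M → ℝ} {x : M} {u : Set M} (hu : u ∈ 𝓝 x)
    (hf : ContMDiffOn I 𝓘(ℝ, ℝ) ∞ f u) :
    ∃ g : C^∞⟮I, M; ℝ⟯, ∀ᶠ y in 𝓝 x, g y = f y := by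
  obtain ⟨ψ, -, hψ⟩ := (SmoothBumpFunction.nhds_basis_tsupport (I := I) x).mem_iff.1
    (interior_mem_nhds.2 hu)
  refine ⟨⟨fun y => ψ y * f y, ?_⟩, ?_⟩
  · have h := ContMDiffOn.smul_section_of_tsupport (I := I) (F := ℝ) (V := Bundle.Trivial M ℝ)
      (s := f) (u := interior u) ψ.contMDiff.contMDiffOn isOpen_interior hψ (fun y hy => by
        rw [contMDiffWithinAt_section]
        exact (hf.mono interior_subset) y hy)
    intro y
    exact (contMDiffAt_section _).1 (h.contMDiffAt)
  filter_upwards [ψ.eventuallyEq_one] with y hy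
  change ψ y * f y = f y
  rw [hy, Pi.one_apply, one_mul]

/-- A field of linear maps is smooth if it maps smooth sections to smooth sections. -/
theorem contMDiff_hom_of_apply {F₂ : Type*} [NormedAddCommGroup F₂] [NormedSpace ℝ F₂]
    {V₂ : M → Type*} [TopologicalSpace (TotalSpace F₂ V₂)]
    [∀ x, AddCommGroup (V₂ x)] [∀ x, Module ℝ (V₂ x)] [∀ x, TopologicalSpace (V₂ x)]
    [∀ x, IsTopologicalAddGroup (V₂ x)] [∀ x, ContinuousSMul ℝ (V₂ x)]
    [FiberBundle F₂ V₂] [VectorBundle ℝ F₂ V₂] [FiniteDimensional ℝ F]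
    [ContMDiffVectorBundle ∞ F V I] (A : Π x : M, V x →L[ℝ] V₂ x)
    (hA : ∀ s : ContMDiffSection I F ∞ V, ContMDiff I (I.prod 𝓘(ℝ, F₂)) ∞
      (fun y => TotalSpace.mk' F₂ y (A y (s y)))) :
    ContMDiff I (I.prod 𝓘(ℝ, F →L[ℝ] F₂)) ∞
      (fun y => TotalSpace.mk' (F →L[ℝ] F₂) (E := fun y => V y →L[ℝ] V₂ y) y (A y)) := by
  intro x
  -- In trivializations the coefficients of `A` are the values on sections that are constant near
  -- `x`, up to cutting off.
  rw [contMDiffAt_hom_bundle]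
  refine ⟨contMDiffAt_id, ?_⟩
  let b := Module.finBasis ℝ F
  have key (c : F) : ContMDiffAt I 𝓘(ℝ, F₂) ∞
      (fun y => ContinuousLinearMap.inCoordinates F V F₂ V₂ x y x y (A y) c) x := by
    have hx : x ∈ (trivializationAt F V x).baseSet := mem_baseSet_trivializationAt' x
    obtain ⟨S, hS⟩ := exists_section_extend (I := I) (F := F) ((trivializationAt F V x).symm x c)
    have h1 := (contMDiffAt_section _).1 ((hA S).contMDiffAt (x := x))
    refine h1.congr_of_eventuallyEq ?_
    filter_upwards [hS, (trivializationAt F V x).open_baseSet.mem_nhds hx,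
      (trivializationAt F₂ V₂ x).open_baseSet.mem_nhds (mem_baseSet_trivializationAt' x)]
      with y hy hyb hyb2
    rw [hy, ContinuousLinearMap.inCoordinates_eq hyb hyb2]
    simp [extend, hx]
  have e (L : F →L[ℝ] F₂) : L = ∑ i, ContinuousLinearMap.smulRightL ℝ F F₂
      (LinearMap.toContinuousLinearMap (b.coord i)) (L (b i)) := by
    ext c
    conv_lhs => rw [← b.sum_repr c]
    rw [map_sum]
    simp
  have h : ContMDiffAt I 𝓘(ℝ, F →L[ℝ] F₂) ∞ (fun y => ∑ i, ContinuousLinearMap.smulRightL ℝ F F₂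
      (LinearMap.toContinuousLinearMap (b.coord i))
      (ContinuousLinearMap.inCoordinates F V F₂ V₂ x y x y (A y) (b i))) x :=
    ContMDiffAt.sum fun i _ => (ContinuousLinearMap.contMDiff _).contMDiffAt.comp x (key (b i))
  exact h.congr_of_eventuallyEq (.of_forall fun y => e _)

/-- The product of a section with a function. -/
def fsmul (f : C^∞⟮I, M; ℝ⟯) (s : ContMDiffSection I F ∞ V) : ContMDiffSection I F ∞ V :=
  ⟨(f : M → ℝ) • (s : Π x, V x), f.contMDiff.smul_section s.contMDiff⟩

@[simp]
theorem fsmul_apply (f : C^∞⟮I, M; ℝ⟯) (s : ContMDiffSection I F ∞ V) (x : M) :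
    fsmul f s x = f x • s x := rfl

theorem mdifferentiableAt_fun (f : C^∞⟮I, M; ℝ⟯) (x : M) : MDifferentiableAt I 𝓘(ℝ, ℝ) f x :=
  f.contMDiff.mdifferentiableAt (by simp)

section Connection

variable (D : CovariantDerivative I F V)

theorem conn_add (s t : ContMDiffSection I F ∞ V) (x : M) : D ⇑(s + t) x = D s x + D t x :=
  D.isCovariantDerivativeOnUniv.add s.mdifferentiableAt t.mdifferentiableAt

theorem conn_smul (c : ℝ) (s : ContMDiffSection I F ∞ V) (x : M) : D ⇑(c • s) x = c • D s x :=
  D.isCovariantDerivativeOnUniv.smul_const c s.mdifferentiableAt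

theorem conn_sub (s t : ContMDiffSection I F ∞ V) (x : M) : D ⇑(s - t) x = D s x - D t x := by
  have h : s - t = s + (-1 : ℝ) • t := by
    rw [neg_one_smul, sub_eq_add_neg]
  rw [h, conn_add, conn_smul]
  module

theorem conn_sum {ι : Type*} (a : Finset ι) (s : ι → ContMDiffSection I F ∞ V) (x : M) :
    D ⇑(∑ i ∈ a, s i) x = ∑ i ∈ a, D (s i) x := by
  classical
  induction a using Finset.induction_on with
  | empty =>
    have h := conn_smul D 0 (0 : ContMDiffSection I F ∞ V) x
    rw [zero_smul, zero_smul] at h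
    simp
  | insert i a hi ih => rw [Finset.sum_insert hi, conn_add, ih, Finset.sum_insert hi]

theorem conn_fsmul (f : C^∞⟮I, M; ℝ⟯) (s : ContMDiffSection I F ∞ V) (x : M)
    (v : TangentSpace I x) :
    D ⇑(fsmul f s) x v = f x • D s x v + mvfderiv I f x v • s x := by
  have h := D.isCovariantDerivativeOnUniv.leibniz (s.mdifferentiableAt (x := x))
    (mdifferentiableAt_fun f x)
  exact congr($h v)

theorem conn_congr {s t : ContMDiffSection I F ∞ V} {x : M} (h : ∀ᶠ y in 𝓝 x, s y = t y) :
    D s x = D t x :=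
  D.isCovariantDerivativeOnUniv.congr_of_eventuallyEq s.mdifferentiableAt t.mdifferentiableAt
    Filter.univ_mem h

end Connection

theorem sum_section_apply {ι : Type*} (a : Finset ι) (s : ι → ContMDiffSection I F ∞ V) (x : M) :
    (∑ i ∈ a, s i) x = ∑ i ∈ a, s i x := by
  rw [← ContMDiffSection.coeAddHom_apply, map_sum]
  simp

end General

section Fields

variable {n : ℕ} {M : Type*} [TopologicalSpace M] [ChartedSpace (EuclideanSpace ℝ (Fin n)) M]
  [IsManifold (𝓡 n) ∞ M] [T2Space M]

variable {F : Type*} [NormedAddCommGroup F] [NormedSpace ℝ F]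
  {V : M → Type*} [TopologicalSpace (TotalSpace F V)]
  [∀ x, AddCommGroup (V x)] [∀ x, Module ℝ (V x)] [∀ x, TopologicalSpace (V x)]
  [∀ x, IsTopologicalAddGroup (V x)] [∀ x, ContinuousSMul ℝ (V x)]
  [FiberBundle F V] [VectorBundle ℝ F V] [ContMDiffVectorBundle ∞ F V (𝓡 n)]

/-- Every covector is the differential of a function that vanishes at the base point: a linear
function in a chart, cut off. -/
theorem exists_function_differential {x : M} (α : Cot n x) :
    ∃ h : C^∞⟮𝓡 n, M; ℝ⟯, h x = 0 ∧ mvfderiv (𝓡 n) h x = α := by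
  let a : EuclideanSpace ℝ (Fin n) →L[ℝ] ℝ := α
  let φ := extChartAt (𝓡 n) x
  let f : M → ℝ := fun y => a (φ y - φ x)
  have hφ : ContMDiffOn (𝓡 n) 𝓘(ℝ, EuclideanSpace ℝ (Fin n)) ∞ φ φ.source := by
    have := contMDiffOn_extChartAt (I := 𝓡 n) (n := ∞) (x := x)
    simpa [φ] using this
  have hf : ContMDiffOn (𝓡 n) 𝓘(ℝ, ℝ) ∞ f φ.source :=
    a.contMDiff.comp_contMDiffOn (hφ.sub contMDiffOn_const)
  have hx : φ.source ∈ 𝓝 x := extChartAt_source_mem_nhds x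
  obtain ⟨h, hh⟩ := exists_function_eventuallyEq hx hf
  refine ⟨h, ?_, ?_⟩
  · rw [hh.self_of_nhds]
    simp [f]
  · have hd : ∀ᶠ y in 𝓝 (φ x), writtenInExtChartAt (𝓡 n) 𝓘(ℝ, ℝ) x h y = a (y - φ x) := by
      have h1 : Filter.Tendsto φ.symm (𝓝 (φ x)) (𝓝 x) := by
        have := (continuousAt_extChartAt_symm (I := 𝓡 n) x).tendsto
        rwa [extChartAt_to_inv] at this
      filter_upwards [h1.eventually hh, extChartAt_target_mem_nhds (I := 𝓡 n) x] with y hy hy'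
      simp only [writtenInExtChartAt, extChartAt_model_space_eq_id, PartialEquiv.refl_coe,
        Function.comp_apply, id]
      exact hy.trans (by simp only [f]; rw [φ.right_inv hy'])
    rw [(mdifferentiableAt_fun h x).mvfderiv, ModelWithCorners.range_eq_univ, fderivWithin_univ,
      Filter.EventuallyEq.fderiv_eq hd]
    have : HasFDerivAt (fun y => a (y - φ x)) a (φ x) :=
      a.hasFDerivAt.comp (φ x) ((hasFDerivAt_id _).sub_const _)
    exact this.fderiv

/-- Every vector of a bundle with connection extends to a smooth section that is parallel at the
base point: the derivative of an arbitrary extension is cancelled by subtracting products with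
functions that vanish at the base point. -/
theorem exists_parallel_extension (D : CovariantDerivative (𝓡 n) F V) {x : M} (v : V x) :
    ∃ S : ContMDiffSection (𝓡 n) F ∞ V, S x = v ∧ D S x = 0 := by
  obtain ⟨S, hS⟩ := exists_section_extend (I := 𝓡 n) (F := F) v
  have hSx : S x = v := by simp [hS.self_of_nhds]
  choose T hT using fun i : Fin n => exists_section_extend (I := 𝓡 n) (F := F) (D S x (frame x i))
  have hTx (i : Fin n) : T i x = D S x (frame x i) := by simp [(hT i).self_of_nhds]
  choose h hx hd using fun i : Fin n => exists_function_differential (coframe x i)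
  refine ⟨S - ∑ i, fsmul (h i) (T i), ?_, ?_⟩
  · simp [sum_section_apply, hx, hSx]
  · ext w
    rw [conn_sub, conn_sum, sub_apply, sum_apply]
    simp only [conn_fsmul, hx, hd, hTx, zero_smul, zero_add]
    conv_lhs => enter [1]; rw [← (frame x).sum_repr w, map_sum]
    simp [coframe]

end Fields

/-! ### Calculus of vector fields and 1-forms -/

section Calculus

variable {n : ℕ} {M : Type*} [TopologicalSpace M] [ChartedSpace (EuclideanSpace ℝ (Fin n)) M]
  [IsManifold (𝓡 n) ∞ M] [T2Space M]

theorem contMDiff_mvfderiv_apply (f : C^∞⟮𝓡 n, M; ℝ⟯) (X : VField n M) :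
    ContMDiff (𝓡 n) 𝓘(ℝ, ℝ) ∞ (fun y => mvfderiv (𝓡 n) f y (X y)) := by
  have h : ContMDiff (𝓡 n) (𝓘(ℝ, ℝ).prod 𝓘(ℝ, ℝ)) ∞
      (fun y => tangentMap (𝓡 n) 𝓘(ℝ, ℝ) f ⟨y, X y⟩) :=
    (f.contMDiff.contMDiff_tangentMap (by simp)).comp X.contMDiff
  intro x
  have h1 := (contMDiffAt_totalSpace.1 (h x)).2
  simp only [tangentMap] at h1
  simpa using! h1

/-- The derivative of a function along a vector field. -/
def der (X : VField n M) (f : C^∞⟮𝓡 n, M; ℝ⟯) : C^∞⟮𝓡 n, M; ℝ⟯ :=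
  ⟨fun y => mvfderiv (𝓡 n) f y (X y), contMDiff_mvfderiv_apply f X⟩

@[simp]
theorem der_apply (X : VField n M) (f : C^∞⟮𝓡 n, M; ℝ⟯) (x : M) :
    der X f x = mvfderiv (𝓡 n) f x (X x) := rfl

theorem contMDiff_iff_trivial {f : M → ℝ} : ContMDiff (𝓡 n) ((𝓡 n).prod 𝓘(ℝ, ℝ)) ∞
      (fun y => TotalSpace.mk' ℝ (E := Bundle.Trivial M ℝ) y (f y)) ↔ ContMDiff (𝓡 n) 𝓘(ℝ, ℝ) ∞ f :=
  forall_congr' fun _ => contMDiffAt_section _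

/-- A field of covectors is smooth if its values on smooth vector fields are. -/
def OneForm.ofApply (α : Π x : M, Cot n x)
    (h : ∀ X : VField n M, ContMDiff (𝓡 n) 𝓘(ℝ, ℝ) ∞ (fun y => (α y (X y) : ℝ))) : OneForm n M :=
  ⟨α, contMDiff_hom_of_apply α fun X => contMDiff_iff_trivial.2 (h X)⟩

/-- The contraction of a 1-form with a vector field. -/
def pair (α : OneForm n M) (X : VField n M) : C^∞⟮𝓡 n, M; ℝ⟯ :=
  ⟨fun y => α y (X y), contMDiff_iff_trivial.1 (α.contMDiff.clm_bundle_apply X.contMDiff)⟩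

@[simp]
theorem pair_apply (α : OneForm n M) (X : VField n M) (x : M) : pair α X x = α x (X x) := rfl

/-- The differential of a smooth function, as a smooth 1-form. -/
def dform (f : C^∞⟮𝓡 n, M; ℝ⟯) : OneForm n M :=
  .ofApply (differential f) (contMDiff_mvfderiv_apply f)

@[simp]
theorem dform_apply (f : C^∞⟮𝓡 n, M; ℝ⟯) (x : M) : dform f x = differential f x := rfl

/-- The contraction `σ^{bc} α_c` of a 2-tensor with a 1-form. -/
def contr (σ : BivField n M) (α : OneForm n M) : VField n M :=
  ⟨fun y => σ y (α y), σ.contMDiff.clm_bundle_apply α.contMDiff⟩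

@[simp]
theorem contr_apply (σ : BivField n M) (α : OneForm n M) (x : M) : contr σ α x = σ x (α x) := rfl

section Connection

variable (D : AffConn n M)

theorem dualConn_apply (α : OneForm n M) (W : VField n M) (x : M) (v : Tan n x) :
    (dualConn D α x v (W x) : ℝ) = mvfderiv (𝓡 n) (pair α W) x v - α x (D W x v) :=
  homDeriv_apply D _ α.mdifferentiableAt W.mdifferentiableAt v

theorem bivDeriv_apply (σ : BivField n M) (α : OneForm n M) (x : M) (v : Tan n x) :
    bivDeriv D σ x v (α x) = D (contr σ α) x v - σ x (dualConn D α x v) :=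
  homDeriv_apply (dualConn D) D σ.mdifferentiableAt α.mdifferentiableAt v

variable [CovariantDerivative.ContMDiffCovariantDerivative D ∞]

/-- The covariant differential of a smooth vector field is smooth. -/
theorem contMDiff_conn (Y : VField n M) :
    ContMDiff (𝓡 n) ((𝓡 n).prod 𝓘(ℝ, EuclideanSpace ℝ (Fin n) →L[ℝ] EuclideanSpace ℝ (Fin n))) ∞
      (fun y => TotalSpace.mk' (EuclideanSpace ℝ (Fin n) →L[ℝ] EuclideanSpace ℝ (Fin n))
        (E := fun y => Tan n y →L[ℝ] Tan n y) y (D Y y)) := fun _ =>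
  contMDiffAt_conn D Filter.univ_mem Y.contMDiff.contMDiffOn

/-- The covariant derivative `X^a ∇_a Y^b` of vector fields. -/
def nab (X Y : VField n M) : VField n M :=
  ⟨fun y => D Y y (X y), (contMDiff_conn D Y).clm_bundle_apply X.contMDiff⟩

@[simp]
theorem nab_apply (X Y : VField n M) (x : M) : nab D X Y x = D Y x (X x) := rfl

/-- The covariant derivative `X^a ∇_a α_b` of a 1-form along a vector field. -/
def nabForm (X : VField n M) (α : OneForm n M) : OneForm n M :=
  .ofApply (fun y => dualConn D α y (X y)) fun W => by
    simp only [dualConn_apply]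
    exact ((der X (pair α W)).contMDiff).sub (pair α (nab D X W)).contMDiff

@[simp]
theorem nabForm_apply (X : VField n M) (α : OneForm n M) (x : M) :
    nabForm D X α x = dualConn D α x (X x) := rfl

theorem secondDeriv_apply (Z U V : VField n M) (x : M) :
    secondDeriv D Z x (U x) (V x) = D (nab D V Z) x (U x) - D Z x (D V x (U x)) :=
  homDeriv_apply D D (A := D Z) ((contMDiff_conn D Z).mdifferentiable (by simp) x)
    V.mdifferentiableAt _

end Connection

theorem mvfderiv_fadd (f g : C^∞⟮𝓡 n, M; ℝ⟯) (x : M) :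
    mvfderiv (𝓡 n) ⇑(f + g) x = mvfderiv (𝓡 n) f x + mvfderiv (𝓡 n) g x :=
  mvfderiv_add (mdifferentiableAt_fun f x) (mdifferentiableAt_fun g x)

theorem mvfderiv_fsub (f g : C^∞⟮𝓡 n, M; ℝ⟯) (x : M) :
    mvfderiv (𝓡 n) ⇑(f - g) x = mvfderiv (𝓡 n) f x - mvfderiv (𝓡 n) g x :=
  mvfderiv_sub (mdifferentiableAt_fun f x) (mdifferentiableAt_fun g x)

theorem mvfderiv_fmul (f g : C^∞⟮𝓡 n, M; ℝ⟯) (x : M) :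
    mvfderiv (𝓡 n) ⇑(f * g) x = f x • mvfderiv (𝓡 n) g x + g x • mvfderiv (𝓡 n) f x :=
  mvfderiv_mul (mdifferentiableAt_fun f x) (mdifferentiableAt_fun g x)

theorem mvfderiv_fsum {ι : Type*} (a : Finset ι) (f : ι → C^∞⟮𝓡 n, M; ℝ⟯) (x : M) :
    mvfderiv (𝓡 n) ⇑(∑ i ∈ a, f i) x = ∑ i ∈ a, mvfderiv (𝓡 n) (f i) x := by
  classical
  induction a using Finset.induction_on with
  | empty =>
    simp
  | insert i a hi ih => rw [Finset.sum_insert hi, mvfderiv_fadd, ih, Finset.sum_insert hi]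

theorem mvfderiv_congr {f g : C^∞⟮𝓡 n, M; ℝ⟯} {x : M} (h : ∀ᶠ y in 𝓝 x, f y = g y) :
    mvfderiv (𝓡 n) f x = mvfderiv (𝓡 n) g x := by
  have := conn_congr (trivialConn (𝓡 n) M)
    (s := ⟨fun y => f y, contMDiff_iff_trivial.2 f.contMDiff⟩)
    (t := ⟨fun y => g y, contMDiff_iff_trivial.2 g.contMDiff⟩) h
  exact this

theorem section_add_apply (X Y : VField n M) (x : M) : (X + Y) x = X x + Y x := rfl

theorem section_sub_apply (X Y : VField n M) (x : M) : (X - Y) x = X x - Y x := rfl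

theorem nab_fsmul_right (D : AffConn n M) [CovariantDerivative.ContMDiffCovariantDerivative D ∞]
    (f : C^∞⟮𝓡 n, M; ℝ⟯) (U V : VField n M) :
    nab D U (fsmul f V) = fsmul (der U f) V + fsmul f (nab D U V) := by
  ext x : 1
  simp [conn_fsmul, add_comm]

section Torsion

variable (D : AffConn n M) [CovariantDerivative.ContMDiffCovariantDerivative D ∞]

/-- The bracket `∇_U V - ∇_V U` defined by a connection; it is the Lie bracket if the connection
is torsion-free. -/
def brk (U V : VField n M) : VField n M := nab D U V - nab D V U

@[simp]
theorem brk_apply (U V : VField n M) (x : M) : brk D U V x = D V x (U x) - D U x (V x) := rfl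

variable {D}

theorem coe_brk (hD : D.torsion = 0) (U V : VField n M) :
    ⇑(brk D U V) = VectorField.mlieBracket (𝓡 n) U V := by
  ext x : 1
  exact D.torsion_eq_zero_iff.1 hD U.mdifferentiableAt V.mdifferentiableAt

/-- The Jacobi identity for vector fields, in terms of a torsion-free connection. -/
theorem brk_jacobi (hD : D.torsion = 0) (U V W : VField n M) :
    brk D U (brk D V W) = brk D (brk D U V) W + brk D V (brk D U W) := by
  have hs (X : VField n M) : ContMDiff (𝓡 n) ((𝓡 n).prod 𝓘(ℝ, EuclideanSpace ℝ (Fin n)))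
      (minSmoothness ℝ 2) (fun y => TotalSpace.mk' (EuclideanSpace ℝ (Fin n)) y (X y)) := by
    simpa using X.contMDiff.of_le (m := 2)
      (WithTop.coe_le_coe.2 le_top : ((2 : ℕ∞) : ℕ∞ω) ≤ ((⊤ : ℕ∞) : ℕ∞ω))
  have : IsManifold (𝓡 n) (minSmoothness ℝ 3) M := by
    simpa using IsManifold.of_le (n := ∞) (m := 3)
      (WithTop.coe_le_coe.2 le_top : ((3 : ℕ∞) : ℕ∞ω) ≤ ((⊤ : ℕ∞) : ℕ∞ω))
  ext x : 1
  rw [section_add_apply]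
  simp only [coe_brk hD]
  exact VectorField.leibniz_identity_mlieBracket_apply (hs U x) (hs V x) (hs W x)

/-- The bracket is the commutator of directional derivatives. This follows from the Jacobi identity
for `U`, `V`, `f W`, whose terms without derivatives of `f` cancel. -/
theorem der_brk (hD : D.torsion = 0) (U V : VField n M) (f : C^∞⟮𝓡 n, M; ℝ⟯) :
    der (brk D U V) f = der U (der V f) - der V (der U f) := by
  ext x
  rcases subsingleton_or_nontrivial (Tan n x) with h | h
  · have hU : U x = 0 := Subsingleton.elim _ _
    have hV : V x = 0 := Subsingleton.elim _ _
    change der _ f x = der U (der V f) x - der V (der U f) x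
    simp [hU, hV]
  obtain ⟨w, hw⟩ := exists_ne (0 : Tan n x)
  obtain ⟨W, hW, -⟩ := exists_parallel_extension D w
  have hr (X Y : VField n M) (g : C^∞⟮𝓡 n, M; ℝ⟯) :
      brk D X (fsmul g Y) = fsmul (der X g) Y + fsmul g (brk D X Y) := by
    ext y : 1
    simp [conn_fsmul]
    module
  have ha (X Y Z : VField n M) : brk D X (Y + Z) = brk D X Y + brk D X Z := by
    ext y : 1
    simp only [brk_apply, conn_add, section_add_apply, add_apply, map_add]
    abel
  have h1 := brk_jacobi hD U V (fsmul f W)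
  have h2 := brk_jacobi hD U V W
  simp only [hr, ha] at h1
  have h1 := congr($h1 x)
  have h2 := congr($h2 x)
  simp only [section_add_apply, fsmul_apply] at h1 h2
  rw [h2] at h1
  have h3 : (der (brk D U V) f x - (der U (der V f) x - der V (der U f) x)) • W x = 0 := by
    linear_combination (norm := module) (-1 : ℝ) • h1
  rw [hW, smul_eq_zero, or_iff_left hw, sub_eq_zero] at h3
  exact h3

end Torsion

end Calculus

/-! ### Curvature as an operator on vector fields -/

section Frame

variable {E : Type*} [NormedAddCommGroup E] [NormedSpace ℝ E] [FiniteDimensional ℝ E]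
  {H : Type*} [TopologicalSpace H] {I : ModelWithCorners ℝ E H}
  {M : Type*} [TopologicalSpace M] [ChartedSpace H M] [T2Space M] [IsManifold I ∞ M]
  {F : Type*} [NormedAddCommGroup F] [NormedSpace ℝ F] [FiniteDimensional ℝ F]
  {V : M → Type*} [TopologicalSpace (TotalSpace F V)]
  [∀ x, AddCommGroup (V x)] [∀ x, Module ℝ (V x)] [∀ x, TopologicalSpace (V x)]
  [∀ x, IsTopologicalAddGroup (V x)] [∀ x, ContinuousSMul ℝ (V x)]
  [FiberBundle F V] [VectorBundle ℝ F V] [ContMDiffVectorBundle ∞ F V I]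

/-- Near a point, every smooth section is a combination of finitely many fixed global sections. -/
theorem exists_spanning_sections (x : M) :
    ∃ e : Fin (finrank ℝ F) → ContMDiffSection I F ∞ V, ∀ Z : ContMDiffSection I F ∞ V,
      ∃ c : Fin (finrank ℝ F) → C^∞⟮I, M; ℝ⟯,
        (∀ᶠ y in 𝓝 x, Z y = (∑ i, fsmul (c i) (e i)) y) ∧ (Z x = 0 → ∀ i, c i x = 0) := by
  let t := trivializationAt F V x
  let b := finBasis ℝ F
  have hx : t.baseSet ∈ 𝓝 x := t.open_baseSet.mem_nhds (mem_baseSet_trivializationAt' x)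
  choose e he using fun i : Fin (finrank ℝ F) => exists_section_eventuallyEq (I := I) hx
    (t.contMDiffOn_localFrame_baseSet ∞ b i)
  refine ⟨e, fun Z => ?_⟩
  choose c hc using fun i : Fin (finrank ℝ F) => exists_function_eventuallyEq (I := I) hx
    (contMDiffOn_baseSet_localFrameCoeff (e := t) b Z.contMDiff.contMDiffOn i)
  refine ⟨c, ?_, fun hZ i => ?_⟩
  · filter_upwards [hx, Filter.eventually_all.2 he, Filter.eventually_all.2 hc] with y hy he hc
    refine (Trivialization.eq_sum_localFrameCoeff_smul (e := t) (b := b) (s := Z) hy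
      (I := I)).trans ?_
    simp [sum_section_apply, he, hc]
  · rw [(hc i).self_of_nhds]
    simp [hZ]

end Frame

section CurvatureApply

variable {n : ℕ} {M : Type*} [TopologicalSpace M] [ChartedSpace (EuclideanSpace ℝ (Fin n)) M]
  [IsManifold (𝓡 n) ∞ M] [T2Space M]
  (D : AffConn n M) [CovariantDerivative.ContMDiffCovariantDerivative D ∞]

theorem secondDeriv_sub_swap (Z U V : VField n M) (x : M) :
    secondDeriv D Z x (U x) (V x) - secondDeriv D Z x (V x) (U x) =
      D (nab D V Z) x (U x) - D (nab D U Z) x (V x) - D Z x (brk D U V x) := by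
  rw [secondDeriv_apply, secondDeriv_apply, brk_apply, map_sub]
  abel

/-- Second derivatives depend on the germ only. -/
theorem secondDeriv_congr {s : Π x : M, Tan n x} {Z : VField n M} {x : M}
    (h : ∀ᶠ y in 𝓝 x, Z y = s y) : secondDeriv D s x = secondDeriv D Z x := by
  have hd (y : M) (hy : ∀ᶠ z in 𝓝 y, Z z = s z) :
      MDifferentiableAt (𝓡 n) ((𝓡 n).prod 𝓘(ℝ, EuclideanSpace ℝ (Fin n)))
        (fun y => TotalSpace.mk' (EuclideanSpace ℝ (Fin n)) y (s y)) y := by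
    refine Z.mdifferentiableAt.congr_of_eventuallyEq ?_
    filter_upwards [hy] with z hz
    rw [hz]
  have hD : ∀ᶠ y in 𝓝 x, D s y = D Z y := by
    filter_upwards [eventually_eventually_nhds.2 h] with y hy
    refine D.isCovariantDerivativeOnUniv.congr_of_eventuallyEq (hd y hy) Z.mdifferentiableAt
      Filter.univ_mem ?_
    filter_upwards [hy] with z hz
    rw [hz]
  have hZ := (contMDiff_conn D Z).mdifferentiable (by simp) x
  refine (homConn D D).isCovariantDerivativeOnUniv.congr_of_eventuallyEq
    (hZ.congr_of_eventuallyEq ?_) hZ Filter.univ_mem hD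
  filter_upwards [hD] with z hz
  rw [hz]

variable {D}

/-- The antisymmetrised second derivative is tensorial in the differentiated field. -/
theorem secondDeriv_sub_swap_fsmul (hD : D.torsion = 0) (f : C^∞⟮𝓡 n, M; ℝ⟯) (Z : VField n M)
    (x : M) (u v : Tan n x) :
    secondDeriv D (fsmul f Z) x u v - secondDeriv D (fsmul f Z) x v u =
      f x • (secondDeriv D Z x u v - secondDeriv D Z x v u) := by
  obtain ⟨U, rfl, -⟩ := exists_parallel_extension D u
  obtain ⟨V, rfl, -⟩ := exists_parallel_extension D v
  have h : mvfderiv (𝓡 n) f x (brk D U V x) =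
      mvfderiv (𝓡 n) (der V f) x (U x) - mvfderiv (𝓡 n) (der U f) x (V x) :=
    congr($(der_brk hD U V f) x)
  rw [secondDeriv_sub_swap, secondDeriv_sub_swap]
  simp only [nab_fsmul_right, conn_add, conn_fsmul, add_apply, h, der_apply, nab_apply]
  module

/-- The curvature applied to vector fields: as the antisymmetrised second derivative is tensorial,
it does not depend on the extension used in the definition of `curv`. -/
theorem curv_apply (hD : D.torsion = 0) (U V Z : VField n M) (x : M) :
    curv D x (U x) (V x) (Z x) =
      D (nab D V Z) x (U x) - D (nab D U Z) x (V x) - D Z x (brk D U V x) := by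
  obtain ⟨S, hS⟩ := exists_section_extend (I := 𝓡 n) (F := EuclideanSpace ℝ (Fin n)) (Z x)
  rw [← secondDeriv_sub_swap, curv, secondDeriv_congr D hS]
  -- `Z - S` vanishes at `x`, hence is a combination of sections with coefficients vanishing at `x`.
  have h0 : (Z - S) x = 0 := by simp [hS.self_of_nhds]
  obtain ⟨e, he⟩ := exists_spanning_sections (I := 𝓡 n) (F := EuclideanSpace ℝ (Fin n))
    (V := (Tan n : M → Type)) x
  obtain ⟨c, hc, hc0⟩ := he (Z - S)
  have h1 (u v : Tan n x) : secondDeriv D ⇑(Z - S) x u v - secondDeriv D ⇑(Z - S) x v u = 0 := by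
    rw [secondDeriv_congr D (Z := ∑ i, fsmul (c i) (e i)) (hc.mono fun y hy => hy.symm)]
    have h2 (u v : Tan n x) : secondDeriv D ⇑(∑ i, fsmul (c i) (e i)) x u v =
        ∑ i, secondDeriv D (fsmul (c i) (e i)) x u v := by
      obtain ⟨U, rfl, -⟩ := exists_parallel_extension D u
      obtain ⟨V, rfl, -⟩ := exists_parallel_extension D v
      have h3 : nab D V (∑ i, fsmul (c i) (e i)) = ∑ i, nab D V (fsmul (c i) (e i)) := by
        ext y : 1
        simp only [nab_apply, conn_sum, sum_section_apply, sum_apply]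
      simp only [secondDeriv_apply, h3, conn_sum, sum_apply, Finset.sum_sub_distrib]
    simp only [h2, ← Finset.sum_sub_distrib, secondDeriv_sub_swap_fsmul hD, hc0 h0, zero_smul,
      Finset.sum_const_zero]
  have h4 (u v : Tan n x) : secondDeriv D ⇑(Z - S) x u v =
      secondDeriv D Z x u v - secondDeriv D S x u v := by
    obtain ⟨U, rfl, -⟩ := exists_parallel_extension D u
    obtain ⟨V, rfl, -⟩ := exists_parallel_extension D v
    have h3 : nab D V (Z - S) = nab D V Z - nab D V S := by
      ext y : 1
      simp only [nab_apply, conn_sub, section_sub_apply, sub_apply]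
    simp only [secondDeriv_apply, h3, conn_sub, sub_apply]
    abel
  have h5 := h1 (U x) (V x)
  rw [h4, h4, sub_sub_sub_comm, sub_eq_zero] at h5
  exact h5.symm

/-- The curvature `R(U, V) Z`, as a smooth vector field. -/
def curvField (hD : D.torsion = 0) (U V Z : VField n M) : VField n M :=
  ⟨fun y => curv D y (U y) (V y) (Z y), by
    have h := (nab D U (nab D V Z) - nab D V (nab D U Z) - nab D (brk D U V) Z).contMDiff
    convert h using 3 with y
    exact curv_apply hD U V Z y⟩

theorem curvField_eq (hD : D.torsion = 0) (U V Z : VField n M) :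
    curvField hD U V Z = nab D U (nab D V Z) - nab D V (nab D U Z) - nab D (brk D U V) Z := by
  ext x : 1
  exact curv_apply hD U V Z x

end CurvatureApply

/-! ### Dual bases, contractions and the Bianchi identities -/

section DualBases

variable {n : ℕ} {M : Type*} [TopologicalSpace M] [ChartedSpace (EuclideanSpace ℝ (Fin n)) M]
  [IsManifold (𝓡 n) ∞ M] {x : M}

/-- The families `e_i` of vectors and `θ^i` of covectors at a point are dual: `θ^i(e_j) = δ^i_j`. -/
def IsDual (e : Fin n → Tan n x) (θ : Fin n → Cot n x) : Prop :=
  ∀ i j, (θ i (e j) : ℝ) = if i = j then 1 else 0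

theorem coframe_apply (i : Fin n) (v : Tan n x) : coframe x i v = (frame x).repr v i := rfl

theorem isDual_frame : IsDual (n := n) (frame x) (coframe x) := by
  intro i j
  rw [coframe_apply, Basis.repr_self, Finsupp.single_apply]
  simp only [eq_comm]

theorem sum_coframe_smul (v : Tan n x) : ∑ i, (coframe x i v : ℝ) • frame x i = v :=
  (frame x).sum_repr v

theorem sum_smul_coframe (α : Cot n x) : ∑ i, (α (frame x i) : ℝ) • coframe x i = α := by
  ext v
  conv_rhs => rw [← sum_coframe_smul v, map_sum]
  rw [sum_apply]
  exact Finset.sum_congr rfl fun i _ => by simp [mul_comm]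

/-- Dual families are dual bases: a one-sided inverse of a square matrix is two-sided. -/
theorem IsDual.sum_smul {e : Fin n → Tan n x} {θ : Fin n → Cot n x} (h : IsDual e θ)
    (v : Tan n x) : ∑ i, (θ i v : ℝ) • e i = v := by
  let A : Matrix (Fin n) (Fin n) ℝ := fun i k => θ i (frame x k)
  let B : Matrix (Fin n) (Fin n) ℝ := fun k j => coframe x k (e j)
  have h1 : A * B = 1 := by
    ext i j
    have h2 : (θ i (e j) : ℝ) = ∑ k, A i k * B k j := by
      conv_lhs => rw [← sum_coframe_smul (e j), map_sum]
      exact Finset.sum_congr rfl fun k _ => by simp [A, B, mul_comm]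
    rw [Matrix.mul_apply, ← h2, h i j, Matrix.one_apply]
  have h2 : B * A = 1 := mul_eq_one_comm.1 h1
  have h3 (k : Fin n) : ∑ i, (θ i (frame x k) : ℝ) • e i = frame x k := by
    rw [← sum_coframe_smul (∑ i, (θ i (frame x k) : ℝ) • e i)]
    have h4 (j : Fin n) : (coframe x j (∑ i, (θ i (frame x k) : ℝ) • e i) : ℝ) =
        if j = k then 1 else 0 := by
      rw [← Matrix.one_apply, ← h2, Matrix.mul_apply, map_sum]
      exact Finset.sum_congr rfl fun i _ => by simp [A, B, mul_comm]
    simp [h4]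
  conv_rhs => rw [← sum_coframe_smul v]
  conv_lhs => enter [2, i]; rw [← sum_coframe_smul v, map_sum]
  simp only [map_smul, Finset.sum_smul, smul_eq_mul, mul_smul]
  rw [Finset.sum_comm]
  simp only [← Finset.smul_sum, h3]

/-- Contractions of bilinear maps can be computed in any pair of dual bases. -/
theorem IsDual.contraction_eq {W : Type*} [AddCommGroup W] [Module ℝ W]
    {e : Fin n → Tan n x} {θ : Fin n → Cot n x} (h : IsDual e θ)
    (B : Tan n x →ₗ[ℝ] Cot n x →ₗ[ℝ] W) :
    ∑ i, B (e i) (θ i) = ∑ i, B (frame x i) (coframe x i) := by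
  have h1 (i : Fin n) : B (e i) (θ i) = ∑ k, B ((θ i (frame x k) : ℝ) • e i) (coframe x k) := by
    conv_lhs => rw [← sum_smul_coframe (θ i), map_sum]
    simp
  simp only [h1]
  rw [Finset.sum_comm]
  refine Finset.sum_congr rfl fun k _ => ?_
  rw [← LinearMap.sum_apply, ← map_sum, h.sum_smul]

/-- The derivative of a volume form along an endomorphism is its multiple by the trace. -/
theorem sum_vol_update (η : (Tan n x) [⋀^Fin n]→ₗ[ℝ] ℝ) (A : Tan n x →ₗ[ℝ] Tan n x) :
    ∑ i, η (Function.update (frame x) i (A (frame x i))) =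
      (∑ i, (coframe x i (A (frame x i)) : ℝ)) * η (frame x) := by
  rw [Finset.sum_mul]
  refine Finset.sum_congr rfl fun i _ => ?_
  conv_lhs => rw [← sum_coframe_smul (A (frame x i))]
  rw [AlternatingMap.map_update_sum]
  simp only [AlternatingMap.map_update_smul]
  rw [Finset.sum_eq_single i]
  · simp
  · intro j _ hj
    rw [AlternatingMap.map_update_self _ _ hj.symm, smul_zero]
  · simp

theorem vol_frame_ne_zero {η : (Tan n x) [⋀^Fin n]→ₗ[ℝ] ℝ} (h : η ≠ 0) : η (frame x) ≠ 0 :=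
  (η.map_basis_ne_zero_iff _).2 h

end DualBases

section ParallelFields

variable {n : ℕ} {M : Type*} [TopologicalSpace M] [ChartedSpace (EuclideanSpace ℝ (Fin n)) M]
  [IsManifold (𝓡 n) ∞ M] [T2Space M]
  {D : AffConn n M} [CovariantDerivative.ContMDiffCovariantDerivative D ∞]
  {x : M}

theorem brk_parallel {U V : VField n M} (hU : D U x = 0) (hV : D V x = 0) : brk D U V x = 0 := by
  simp [hU, hV]

theorem curv_parallel (hD : D.torsion = 0) (U V : VField n M) {Z : VField n M} (hZ : D Z x = 0) :
    curv D x (U x) (V x) (Z x) = D (nab D V Z) x (U x) - D (nab D U Z) x (V x) := by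
  rw [curv_apply hD, hZ, zero_apply, sub_zero]

theorem curv_swap (u v w : Tan n x) : curv D x v u w = -curv D x u v w := by
  simp [curv]

/-- The curvature as a trilinear map. -/
def curvLin (D : AffConn n M) [CovariantDerivative.ContMDiffCovariantDerivative D ∞] (x : M) :
    Tan n x →ₗ[ℝ] Tan n x →ₗ[ℝ] Tan n x →ₗ[ℝ] Tan n x :=
  LinearMap.mk₂ ℝ (fun u v =>
    { toFun := curv D x u v
      map_add' w w' := by simpa using curv_linear D u v 1 w w'
      map_smul' c w := by
        have h0 : curv D x u v 0 = 0 := by simpa using curv_linear D u v 1 0 0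
        simpa [h0] using curv_linear D u v c w 0 })
    (by intros; ext; simp [curv]; abel) (by intros; ext; simp [curv, smul_sub])
    (by intros; ext; simp [curv]; abel) (by intros; ext; simp [curv, smul_sub])

@[simp]
theorem curvLin_apply (u v w : Tan n x) : curvLin D x u v w = curv D x u v w := rfl

/-- The first Bianchi identity. -/
theorem curv_bianchi (hD : D.torsion = 0) (u v w : Tan n x) :
    curv D x u v w + curv D x v w u + curv D x w u v = 0 := by
  obtain ⟨U, rfl, hU⟩ := exists_parallel_extension D u
  obtain ⟨V, rfl, hV⟩ := exists_parallel_extension D v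
  obtain ⟨W, rfl, hW⟩ := exists_parallel_extension D w
  rw [curv_parallel hD _ _ hU, curv_parallel hD _ _ hV, curv_parallel hD _ _ hW]
  have h := congr($(brk_jacobi hD U V W) x)
  rw [section_add_apply, brk_apply, brk_apply D (brk D U V), brk_apply D V (brk D U W), hU, hV,
    hW] at h
  simp only [brk, conn_sub, sub_apply, zero_apply] at h
  linear_combination (norm := module) h

/-- The endomorphism field `R(V, W)`. -/
def curvEnd (D : AffConn n M) [CovariantDerivative.ContMDiffCovariantDerivative D ∞]
    (V W : VField n M) (x : M) : Tan n x →L[ℝ] Tan n x :=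
  LinearMap.toContinuousLinearMap (curvLin D x (V x) (W x))

theorem contMDiff_curvEnd (hD : D.torsion = 0) (V W : VField n M) :
    ContMDiff (𝓡 n) ((𝓡 n).prod 𝓘(ℝ, EuclideanSpace ℝ (Fin n) →L[ℝ] EuclideanSpace ℝ (Fin n))) ∞
      (fun y => TotalSpace.mk' (EuclideanSpace ℝ (Fin n) →L[ℝ] EuclideanSpace ℝ (Fin n))
        (E := fun y => Tan n y →L[ℝ] Tan n y) y (curvEnd D V W y)) :=
  contMDiff_hom_of_apply _ fun Z => (curvField hD V W Z).contMDiff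

/-- The covariant derivative of `R(V, W)`; where `V` and `W` are parallel it is `(∇R)(V, W)`. -/
def curvEndDeriv (D : AffConn n M) [CovariantDerivative.ContMDiffCovariantDerivative D ∞]
    (V W : VField n M) (x : M) : Tan n x →L[ℝ] Tan n x →L[ℝ] Tan n x :=
  homConn D D (curvEnd D V W) x

theorem curvEndDeriv_apply (hD : D.torsion = 0) (V W Z : VField n M) (u : Tan n x) :
    curvEndDeriv D V W x u (Z x) =
      D (curvField hD V W Z) x u - curv D x (V x) (W x) (D Z x u) :=
  homDeriv_apply D D ((contMDiff_curvEnd hD V W).mdifferentiable (by simp) x)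
    Z.mdifferentiableAt u

/-- The second Bianchi identity. For parallel fields it is the Jacobi identity for covariant
derivatives, whose terms cancel in pairs because the curvature annihilates fields that vanish at
`x`. -/
theorem curvEndDeriv_bianchi (hD : D.torsion = 0) {U V W : VField n M} (hU : D U x = 0)
    (hV : D V x = 0) (hW : D W x = 0) (z : Tan n x) :
    curvEndDeriv D V W x (U x) z + curvEndDeriv D W U x (V x) z +
      curvEndDeriv D U V x (W x) z = 0 := by
  obtain ⟨Z, rfl, hZ⟩ := exists_parallel_extension D z
  have h0 (u v : Tan n x) : curv D x u v 0 = 0 := (curvLin D x u v).map_zero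
  have h1 {A B C : VField n M} (hA : D A x = 0) (hB : D B x = 0) :
      curvEndDeriv D A B x (C x) (Z x) =
        D (nab D A (nab D B Z)) x (C x) - D (nab D B (nab D A Z)) x (C x) := by
    have h2 := secondDeriv_apply D Z C (brk D A B) x
    rw [brk_parallel hA hB, hZ, map_zero, zero_apply, sub_zero] at h2
    rw [curvEndDeriv_apply hD, curvField_eq, conn_sub, conn_sub, sub_apply, sub_apply, ← h2, hZ,
      zero_apply, h0, sub_zero, sub_zero]
  have h3 {A C : VField n M} (B : VField n M) (hA : D A x = 0) (hC : D C x = 0) :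
      D (nab D A (nab D B Z)) x (C x) = D (nab D C (nab D B Z)) x (A x) := by
    have h4 := curv_apply hD C A (nab D B Z) x
    rw [brk_parallel hC hA, nab_apply D B Z, hZ, zero_apply, h0, map_zero, sub_zero] at h4
    exact (sub_eq_zero.1 h4.symm)
  rw [h1 hV hW, h1 hW hU, h1 hU hV, h3 W hV hU, h3 U hW hV, h3 V hU hW]
  abel

end ParallelFields

/-! ### Parallel frames and the Ricci tensor of a special connection -/

section SpecialFrames

variable {n : ℕ} {M : Type*} [TopologicalSpace M] [ChartedSpace (EuclideanSpace ℝ (Fin n)) M]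
  [IsManifold (𝓡 n) ∞ M] [T2Space M]

/-- Global sections which near `x` form dual frames and which are parallel at `x`. -/
structure ParallelFrame (D : AffConn n M) (x : M) where
  e : Fin n → VField n M
  θ : Fin n → OneForm n M
  e_at : ∀ i, e i x = frame x i
  θ_at : ∀ i, θ i x = coframe x i
  isDual : ∀ᶠ y in 𝓝 x, IsDual (fun i => e i y) (fun i => θ i y)
  parallel : ∀ i, D (e i) x = 0

namespace ParallelFrame

variable {D : AffConn n M} [CovariantDerivative.ContMDiffCovariantDerivative D ∞] {x : M}
  (P : ParallelFrame D x)

theorem dualConn_θ (i : Fin n) : dualConn D (P.θ i) x = 0 := by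
  ext v w
  have h1 (j : Fin n) : (dualConn D (P.θ i) x v (frame x j) : ℝ) = 0 := by
    have h := dualConn_apply D (P.θ i) (P.e j) x v
    rw [P.e_at, P.parallel, zero_apply, map_zero, sub_zero] at h
    rw [h, mvfderiv_congr (g := ContMDiffMap.const (if i = j then 1 else 0))
      (P.isDual.mono fun y hy => hy i j)]
    exact congr($(mvfderiv_const (I := 𝓡 n) (if i = j then (1 : ℝ) else 0) (x := x)) v)
  rw [← sum_coframe_smul w, map_sum]
  simp only [map_smul]
  refine Finset.sum_eq_zero fun j _ => ?_
  rw [h1 j, smul_zero]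

/-- The derivative of a coefficient in a coframe that is parallel at the base point. -/
theorem mvfderiv_pair_θ (i : Fin n) (Y : VField n M) (v : Tan n x) :
    mvfderiv (𝓡 n) (pair (P.θ i) Y) x v = coframe x i (D Y x v) := by
  have h := dualConn_apply D (P.θ i) Y x v
  rw [P.dualConn_θ, P.θ_at] at h
  exact (sub_eq_zero.1 h.symm)

end ParallelFrame

theorem update_section_apply (e : Fin n → VField n M) (i : Fin n) (X : VField n M) (y : M) :
    (fun j => Function.update e i X j y) = Function.update (fun j => e j y) i (X y) := by
  ext j : 1
  exact Function.apply_update (fun _ (Z : VField n M) => Z y) e i X j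

variable (S : SpecialConnection n M)

/-- The component of the volume form in given vector fields. -/
def volFun (e : Fin n → VField n M) : C^∞⟮𝓡 n, M; ℝ⟯ :=
  ⟨fun y => S.vol y (fun i => e i y), S.vol_smooth e⟩

theorem volFun_apply (e : Fin n → VField n M) (x : M) :
    volFun S e x = S.vol x (fun i => e i x) := rfl

theorem mvfderiv_volFun (e : Fin n → VField n M) (x : M) (v : Tan n x) :
    mvfderiv (𝓡 n) (volFun S e) x v =
      ∑ i, S.vol x (Function.update (fun j => e j x) i (S.conn (e i) x v)) :=
  S.vol_parallel e x v

theorem exists_parallelFrame (x : M) : Nonempty (ParallelFrame S.conn x) := by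
  choose e he hp using fun i : Fin n => exists_parallel_extension S.conn (frame x i)
  have hx : volFun S e x ≠ 0 := by
    rw [volFun_apply]
    simp only [he]
    exact vol_frame_ne_zero (S.vol_ne_zero x)
  have hu : {y | volFun S e y ≠ 0} ∈ 𝓝 x :=
    (volFun S e).contMDiff.continuous.continuousAt.eventually_ne hx
  obtain ⟨k, hk⟩ := exists_function_eventuallyEq (I := 𝓡 n) (f := fun y => (volFun S e y)⁻¹) hu
    fun y hy => ((volFun S e).contMDiff.contMDiffAt.inv₀ hy).contMDiffWithinAt
  -- Cramer's rule: the dual coframe is a quotient of values of the volume form.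
  let θ (i : Fin n) : OneForm n M := .ofApply (fun y => k y • LinearMap.toContinuousLinearMap
    ((S.vol y).toMultilinearMap.toLinearMap (fun j => e j y) i)) fun X => by
      refine (k * volFun S (Function.update e i X)).contMDiff.congr fun y => ?_
      change _ = k y * S.vol y _
      rw [update_section_apply]
      rfl
  have hd : ∀ᶠ y in 𝓝 x, IsDual (fun i => e i y) (fun i => θ i y) := by
    filter_upwards [hk, hu] with y hky hy i j
    have h : (θ i y (e j y) : ℝ) = k y * S.vol y (Function.update (fun j => e j y) i (e j y)) := rfl
    rw [h]
    split_ifs with hij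
    · subst hij
      rw [Function.update_eq_self, hky]
      exact inv_mul_cancel₀ hy
    · rw [AlternatingMap.map_update_self _ (fun j => e j y) hij, mul_zero]
  refine ⟨⟨e, θ, he, fun i => ?_, hd, hp⟩⟩
  have h := hd.self_of_nhds
  simp only [he] at h
  ext v
  rw [← sum_coframe_smul v, map_sum, map_sum]
  refine Finset.sum_congr rfl fun j _ => ?_
  rw [map_smul, map_smul, h i j, isDual_frame i j]

/-- Curvature endomorphisms of a connection preserving a volume form are trace-free: the commutator
of two derivatives of a component of the volume form vanishes. -/
theorem trace_curv (x : M) (u v : Tan n x) :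
    ∑ i, (coframe x i (curv S.conn x u v (frame x i)) : ℝ) = 0 := by
  obtain ⟨U, rfl, hU⟩ := exists_parallel_extension S.conn u
  obtain ⟨V, rfl, hV⟩ := exists_parallel_extension S.conn v
  choose e he hp using fun i : Fin n => exists_parallel_extension S.conn (frame x i)
  have hder (V : VField n M) : der V (volFun S e) =
      ∑ i, volFun S (Function.update e i (nab S.conn V (e i))) := by
    ext y
    rw [der_apply, mvfderiv_volFun, ← ContMDiffMap.coeFnAddMonoidHom_apply, map_sum,
      Finset.sum_apply]
    refine Finset.sum_congr rfl fun i _ => ?_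
    rw [ContMDiffMap.coeFnAddMonoidHom_apply, volFun_apply, update_section_apply]
    rfl
  have h2 (U V : VField n M) : mvfderiv (𝓡 n) (der V (volFun S e)) x (U x) =
      ∑ i, S.vol x (Function.update (frame x) i (S.conn (nab S.conn V (e i)) x (U x))) := by
    rw [hder, mvfderiv_fsum, sum_apply]
    refine Finset.sum_congr rfl fun i _ => ?_
    rw [mvfderiv_volFun, Finset.sum_eq_single i]
    · rw [update_section_apply, Function.update_self, Function.update_idem]
      simp only [he]
    · intro j _ hj
      rw [Function.update_of_ne hj, hp, zero_apply]
      exact (S.vol x).map_coord_zero j (Function.update_self _ _ _)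
    · simp
  have h := congr($(der_brk S.torsionFree U V (volFun S e)) x)
  have h3 : der (brk S.conn U V) (volFun S e) x = 0 := by
    rw [der_apply, brk_parallel hU hV, map_zero]
  rw [h3] at h
  have h4 : (0 : ℝ) = mvfderiv (𝓡 n) (der V (volFun S e)) x (U x) -
    mvfderiv (𝓡 n) (der U (volFun S e)) x (V x) := h
  rw [h2, h2, ← Finset.sum_sub_distrib] at h4
  simp only [← AlternatingMap.map_update_sub] at h4
  have h5 (i : Fin n) : S.conn (nab S.conn V (e i)) x (U x) - S.conn (nab S.conn U (e i)) x (V x) =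
      curvLin S.conn x (U x) (V x) (frame x i) := by
    rw [curvLin_apply, ← he, curv_parallel S.torsionFree U V (hp i)]
  simp only [h5, sum_vol_update] at h4
  exact (mul_eq_zero.1 h4.symm).resolve_right (vol_frame_ne_zero (S.vol_ne_zero x))

/-- By the first Bianchi identity, the skew part of the Ricci tensor is the trace of the curvature
endomorphisms. -/
theorem ricci_symm (x : M) (u v : Tan n x) : ricci S.conn x u v = ricci S.conn x v u := by
  have h1 (i : Fin n) : (coframe x i (curv S.conn x (frame x i) u v) : ℝ) =
      coframe x i (curv S.conn x (frame x i) v u) -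
        coframe x i (curv S.conn x u v (frame x i)) := by
    rw [← map_sub]
    congr 1
    have := curv_bianchi S.torsionFree (frame x i) u v
    rw [curv_swap (frame x i) v u] at this
    linear_combination (norm := module) this
  rw [ricci, Finset.sum_congr rfl fun i _ => h1 i, Finset.sum_sub_distrib, trace_curv, sub_zero]
  rfl

theorem schouten_apply (D : AffConn n M) [CovariantDerivative.ContMDiffCovariantDerivative D ∞]
    (x : M) (u v : Tan n x) :
    (schouten D x u v : ℝ) = ((n : ℝ) - 1)⁻¹ * ricci D x u v := rfl

theorem schouten_symm (x : M) (u v : Tan n x) :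
    (schouten S.conn x u v : ℝ) = schouten S.conn x v u := by
  rw [schouten_apply, schouten_apply, ricci_symm]

/-- The Ricci tensor computed in a local frame. -/
theorem ricci_eventually_eq {x : M} (P : ParallelFrame S.conn x) (U V : VField n M) :
    ∀ᶠ y in 𝓝 x, ricci S.conn y (U y) (V y) =
      (∑ i, pair (P.θ i) (curvField S.torsionFree (P.e i) U V)) y := by
  filter_upwards [P.isDual] with y hy
  rw [← ContMDiffMap.coeFnAddMonoidHom_apply, map_sum, Finset.sum_apply]
  let B : Tan n y →ₗ[ℝ] Cot n y →ₗ[ℝ] ℝ := LinearMap.mk₂ ℝ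
    (fun u α => α (curv S.conn y u (U y) (V y))) (by intros; simp [curv]; ring)
    (by intros; simp [curv]; ring) (by intros; simp) (by intros; simp)
  exact (hy.contraction_eq B).symm

theorem contMDiff_ricci (U V : VField n M) :
    ContMDiff (𝓡 n) 𝓘(ℝ, ℝ) ∞ (fun y => ricci S.conn y (U y) (V y)) := by
  intro x
  obtain ⟨P⟩ := exists_parallelFrame S x
  exact (ContMDiffMap.contMDiff _).contMDiffAt.congr_of_eventuallyEq (ricci_eventually_eq S P U V)

/-- The 1-form `V^b P_{bc}`. -/
def schoutenForm (V : VField n M) : OneForm n M :=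
  .ofApply (fun y => schouten S.conn y (V y)) fun W =>
    contMDiff_const.mul (contMDiff_ricci S V W)

@[simp]
theorem schoutenForm_apply (V : VField n M) (x : M) :
    schoutenForm S V x = schouten S.conn x (V x) := rfl

theorem contMDiff_schouten : ContMDiff (𝓡 n) ((𝓡 n).prod
    𝓘(ℝ, EuclideanSpace ℝ (Fin n) →L[ℝ] EuclideanSpace ℝ (Fin n) →L[ℝ] ℝ)) ∞
    (fun y => TotalSpace.mk' (EuclideanSpace ℝ (Fin n) →L[ℝ] EuclideanSpace ℝ (Fin n) →L[ℝ] ℝ)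
      (E := fun y => Tan n y →L[ℝ] Cot n y) y (schouten S.conn y)) :=
  contMDiff_hom_of_apply _ fun V => (schoutenForm S V).contMDiff

theorem schoutenDeriv_apply (V : VField n M) (x : M) (u : Tan n x) :
    schoutenDeriv S.conn x u (V x) =
      dualConn S.conn (schoutenForm S V) x u - schouten S.conn x (S.conn V x u) :=
  homDeriv_apply S.conn (dualConn S.conn) ((contMDiff_schouten S).mdifferentiable (by simp) x)
    V.mdifferentiableAt u

theorem schoutenDeriv_apply_apply (V W : VField n M) (x : M) (u : Tan n x) :
    (schoutenDeriv S.conn x u (V x) (W x) : ℝ) =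
      mvfderiv (𝓡 n) (pair (schoutenForm S V) W) x u - schouten S.conn x (V x) (S.conn W x u)
        - schouten S.conn x (S.conn V x u) (W x) := by
  rw [schoutenDeriv_apply, sub_apply, dualConn_apply]
  rfl

/-- The trace of the covariant derivative of the curvature is the derivative of its trace. -/
theorem trace_curvEndDeriv (hn : n ≠ 1) {x : M} (P : ParallelFrame S.conn x) {V : VField n M}
    (hV : S.conn V x = 0) (u z : Tan n x) :
    ∑ i, (coframe x i (curvEndDeriv S.conn (P.e i) V x u z) : ℝ) =
      ((n : ℝ) - 1) * schoutenDeriv S.conn x u (V x) z := by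
  obtain ⟨Z, rfl, hZ⟩ := exists_parallel_extension S.conn z
  have hn' : (n : ℝ) - 1 ≠ 0 := sub_ne_zero.2 (by exact_mod_cast hn)
  have h1 (i : Fin n) : (coframe x i (curvEndDeriv S.conn (P.e i) V x u (Z x)) : ℝ) =
      mvfderiv (𝓡 n) (pair (P.θ i) (curvField S.torsionFree (P.e i) V Z)) x u := by
    rw [P.mvfderiv_pair_θ, curvEndDeriv_apply S.torsionFree, hZ, zero_apply]
    have h0 : curv S.conn x (P.e i x) (V x) 0 = 0 := (curvLin S.conn x _ _).map_zero
    rw [h0, sub_zero]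
  rw [Finset.sum_congr rfl fun i _ => h1 i, ← sum_apply, ← mvfderiv_fsum,
    schoutenDeriv_apply_apply, hV, hZ, zero_apply, map_zero, map_zero, zero_apply, sub_zero,
    sub_zero]
  have h2 : mvfderiv (𝓡 n) (pair (schoutenForm S V) Z) x u = ((n : ℝ) - 1)⁻¹ *
      mvfderiv (𝓡 n) ⇑(∑ i, pair (P.θ i) (curvField S.torsionFree (P.e i) V Z)) x u := by
    rw [mvfderiv_congr (g := ContMDiffMap.const ((n : ℝ) - 1)⁻¹ *
      ∑ i, pair (P.θ i) (curvField S.torsionFree (P.e i) V Z))]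
    · have h3 : mvfderiv (𝓡 n) ⇑(ContMDiffMap.const ((n : ℝ) - 1)⁻¹ : C^∞⟮𝓡 n, M; ℝ⟯) x = 0 :=
        mvfderiv_const _
      rw [mvfderiv_fmul, h3, smul_zero, add_zero]
      rfl
    · filter_upwards [ricci_eventually_eq S P V Z] with y hy
      change ((n : ℝ) - 1)⁻¹ * ricci S.conn y (V y) (Z y) = _ * _
      rw [hy]
      rfl
  rw [h2, mul_inv_cancel_left₀ hn']

end SpecialFrames

/-! ### Curvature under a projective change -/

section ProjectiveChange

variable {n : ℕ} {M : Type*} [TopologicalSpace M] [ChartedSpace (EuclideanSpace ℝ (Fin n)) M]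
  [IsManifold (𝓡 n) ∞ M] [T2Space M]

/-- `D'` is the projective change of `D` by the exact 1-form `df`. -/
def IsProjChange (D D' : AffConn n M) (f : C^∞⟮𝓡 n, M; ℝ⟯) : Prop :=
  ∀ (X : VField n M) (x : M) (v : Tan n x), D' X x v =
    D X x v + (differential f x v : ℝ) • X x + (differential f x (X x) : ℝ) • v

/-- The function `e^{c f}`. -/
def expFun (c : ℝ) (f : C^∞⟮𝓡 n, M; ℝ⟯) : C^∞⟮𝓡 n, M; ℝ⟯ :=
  ⟨fun y => Real.exp (c * f y),
    Real.contDiff_exp.contMDiff.comp (contMDiff_const.mul f.contMDiff)⟩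

@[simp]
theorem expFun_apply (c : ℝ) (f : C^∞⟮𝓡 n, M; ℝ⟯) (x : M) : expFun c f x = Real.exp (c * f x) :=
  rfl

theorem mvfderiv_expFun (c : ℝ) (f : C^∞⟮𝓡 n, M; ℝ⟯) (x : M) (v : Tan n x) :
    mvfderiv (𝓡 n) (expFun c f) x v = c * (differential f x v : ℝ) * expFun c f x := by
  have hg : HasDerivAt (fun t => Real.exp (c * t)) (Real.exp (c * f x) * (c * 1)) (f x) :=
    ((hasDerivAt_id (f x)).const_mul c).exp
  have h := hg.hasFDerivAt.hasMFDerivAt.comp x (mdifferentiableAt_fun f x).hasMFDerivAt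
  have h1 : mvfderiv (𝓡 n) (expFun c f) x v =
      (differential f x v : ℝ) * (Real.exp (c * f x) * (c * 1)) := by
    unfold mvfderiv
    have := h.mfderiv
    exact congr($this v)
  rw [h1, expFun_apply]
  ring

/-- Two connections in the projective class of a third one differ by an exact projective change,
whose 1-form is read off from the derivatives of the two volume forms in a frame that is parallel
at a given point. -/
theorem isProjChange_of_volRescaling {S S₁ S₂ : SpecialConnection n M}
    (h₁ : ProjEquiv S.conn S₁.conn) (h₂ : ProjEquiv S.conn S₂.conn)
    {f : C^∞⟮𝓡 n, M; ℝ⟯} (hf : VolRescaling S₁ S₂ f) : IsProjChange S₁.conn S₂.conn f := by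
  obtain ⟨Υ₁, h₁⟩ := h₁
  obtain ⟨Υ₂, h₂⟩ := h₂
  have h (X : VField n M) (x : M) (v : Tan n x) : S₂.conn X x v = S₁.conn X x v +
      ((Υ₂ x v : ℝ) - Υ₁ x v) • X x + ((Υ₂ x (X x) : ℝ) - Υ₁ x (X x)) • v := by
    rw [h₁ X x X.mdifferentiableAt, h₂ X x X.mdifferentiableAt]
    module
  have key (x : M) (v : Tan n x) : (differential f x v : ℝ) = Υ₂ x v - Υ₁ x v := by
    choose e he hp using fun i : Fin n => exists_parallel_extension S₁.conn (frame x i)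
    have hd₁ : mvfderiv (𝓡 n) (volFun S₁ e) x v = 0 := by
      rw [mvfderiv_volFun]
      refine Finset.sum_eq_zero fun i _ => ?_
      rw [hp, zero_apply]
      exact (S₁.vol x).map_coord_zero i (Function.update_self _ _ _)
    let A : Tan n x →ₗ[ℝ] Tan n x := ((Υ₂ x v : ℝ) - Υ₁ x v) • LinearMap.id +
      LinearMap.smulRight (Υ₂ x - Υ₁ x : Cot n x).toLinearMap v
    have hd₂ : mvfderiv (𝓡 n) (volFun S₂ e) x v =
        (((n : ℝ) + 1) * (Υ₂ x v - Υ₁ x v)) * volFun S₂ e x := by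
      have hA (i : Fin n) : S₂.conn (e i) x v = A (frame x i) := by
        rw [h, hp, he, zero_apply, zero_add]
        rfl
      have htr : ∑ i, (coframe x i (A (frame x i)) : ℝ) = ((n : ℝ) + 1) * (Υ₂ x v - Υ₁ x v) := by
        have h1 (i : Fin n) : (coframe x i (A (frame x i)) : ℝ) = (Υ₂ x v - Υ₁ x v) +
            (Υ₂ x - Υ₁ x : Cot n x) ((coframe x i v : ℝ) • frame x i) := by
          have h2 : (coframe x i (A (frame x i)) : ℝ) = (Υ₂ x v - Υ₁ x v) *
            coframe x i (frame x i) + (Υ₂ x - Υ₁ x : Cot n x) (frame x i) * coframe x i v := by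
            simp [A]
          rw [h2, isDual_frame i i, if_pos rfl, map_smul, smul_eq_mul]
          ring
        simp only [h1]
        rw [Finset.sum_add_distrib, ← map_sum, sum_coframe_smul]
        simp
        ring
      rw [mvfderiv_volFun, volFun_apply, ← htr]
      simp only [hA, he]
      exact sum_vol_update _ _
    have he : mvfderiv (𝓡 n) (volFun S₂ e) x v =
        (((n : ℝ) + 1) * differential f x v) * volFun S₂ e x := by
      have hc : volFun S₂ e = expFun (n + 1) f * volFun S₁ e := by
        ext y
        change S₂.vol y _ = Real.exp _ * S₁.vol y _
        rw [hf y]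
        rfl
      rw [hc, mvfderiv_fmul, add_apply, smul_apply, smul_apply, hd₁, mvfderiv_expFun]
      change _ = _ * (expFun (n + 1) f x * _)
      simp only [smul_eq_mul]
      ring
    rw [he] at hd₂
    have hv : volFun S₂ e x ≠ 0 := by
      rw [volFun_apply]
      simp only [‹∀ i, e i x = frame x i›]
      exact vol_frame_ne_zero (S₂.vol_ne_zero x)
    have hn : (n : ℝ) + 1 ≠ 0 := by positivity
    exact mul_left_cancel₀ hn (mul_right_cancel₀ hv hd₂)
  intro X x v
  rw [h, key, key]

/-- The derivative of a contraction with a field that is parallel at the point. -/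
theorem mvfderiv_pair (D : AffConn n M) (α : OneForm n M) {W : VField n M} {x : M}
    (hW : D W x = 0) (v : Tan n x) :
    mvfderiv (𝓡 n) (pair α W) x v = dualConn D α x v (W x) := by
  rw [dualConn_apply, hW, zero_apply, map_zero, sub_zero]

/-- The second derivative of a 1-form, evaluated on a field that is parallel at the point. -/
theorem mvfderiv_pair_nabForm (D : AffConn n M)
    [CovariantDerivative.ContMDiffCovariantDerivative D ∞] (α : OneForm n M) (V : VField n M)
    {W : VField n M} {x : M} (hW : D W x = 0) (u : Tan n x) :
    mvfderiv (𝓡 n) (pair (nabForm D V α) W) x u =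
      mvfderiv (𝓡 n) (der V (pair α W)) x u - (α x (D (nab D V W) x u) : ℝ) := by
  have h1 : pair (nabForm D V α) W = der V (pair α W) - pair α (nab D V W) := by
    ext y
    exact dualConn_apply D α W y (V y)
  have h2 := dualConn_apply D α (nab D V W) x u
  rw [nab_apply, hW, zero_apply, map_zero] at h2
  rw [h1, mvfderiv_fsub, sub_apply, sub_eq_zero.1 h2.symm]

/-- The tensor `∇_a Υ_b - Υ_a Υ_b` for `Υ = df`, by which the Schouten tensor decreases under the
projective change by `df`. -/
def schoutenChange (D : AffConn n M) (f : C^∞⟮𝓡 n, M; ℝ⟯) (x : M) (v w : Tan n x) : ℝ :=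
  (dualConn D (dform f) x v w : ℝ) - (differential f x v : ℝ) * differential f x w

/-- The Hessian of a function with respect to a torsion-free connection is symmetric. -/
theorem hessian_symm {D : AffConn n M} [CovariantDerivative.ContMDiffCovariantDerivative D ∞]
    (hD : D.torsion = 0) (f : C^∞⟮𝓡 n, M; ℝ⟯) (x : M) (v w : Tan n x) :
    (dualConn D (dform f) x v w : ℝ) = dualConn D (dform f) x w v := by
  obtain ⟨V, rfl, hV⟩ := exists_parallel_extension D v
  obtain ⟨W, rfl, hW⟩ := exists_parallel_extension D w
  have h : der (brk D V W) f x = mvfderiv (𝓡 n) (der W f) x (V x) -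
    mvfderiv (𝓡 n) (der V f) x (W x) := congr($(der_brk hD V W f) x)
  rw [der_apply, brk_parallel hV hW, map_zero] at h
  rw [← mvfderiv_pair D _ hW, ← mvfderiv_pair D _ hV]
  exact (sub_eq_zero.1 h.symm)

namespace IsProjChange

variable {S S' : SpecialConnection n M} {f : C^∞⟮𝓡 n, M; ℝ⟯} (h : IsProjChange S.conn S'.conn f)
include h

theorem dualConn_eq (α : OneForm n M) (x : M) (v w : Tan n x) :
    (dualConn S'.conn α x v w : ℝ) = (dualConn S.conn α x v w : ℝ) -
      (differential f x v : ℝ) * α x w - (differential f x w : ℝ) * α x v := by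
  obtain ⟨W, rfl, -⟩ := exists_parallel_extension S.conn w
  rw [dualConn_apply, dualConn_apply, h W, map_add, map_add, map_smul, map_smul]
  simp only [smul_eq_mul]
  ring

theorem curv_eq (x : M) (u v w : Tan n x) : curv S'.conn x u v w =
    curv S.conn x u v w + schoutenChange S.conn f x u w • v -
      schoutenChange S.conn f x v w • u := by
  obtain ⟨U, rfl, hU⟩ := exists_parallel_extension S.conn u
  obtain ⟨V, rfl, hV⟩ := exists_parallel_extension S.conn v
  obtain ⟨W, rfl, hW⟩ := exists_parallel_extension S.conn w
  have hn (V : VField n M) : nab S'.conn V W =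
      nab S.conn V W + fsmul (pair (dform f) V) W + fsmul (pair (dform f) W) V := by
    ext y : 1
    exact h W y (V y)
  have hb : brk S'.conn U V x = 0 := by
    rw [brk_apply, h V, h U, hU, hV, zero_apply, zero_apply]
    module
  rw [curv_apply S'.torsionFree, curv_parallel S.torsionFree _ _ hW, hb, map_zero, sub_zero,
    hn, hn, h, h]
  simp only [section_add_apply, conn_add, conn_fsmul, add_apply, fsmul_apply, hU, hV, hW,
    mvfderiv_pair S.conn (dform f) hU, mvfderiv_pair S.conn (dform f) hV,
    mvfderiv_pair S.conn (dform f) hW, nab_apply, zero_apply, pair_apply, dform_apply,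
    schoutenChange, hessian_symm S.torsionFree f x (V x) (U x), map_add, map_smul, map_zero,
    smul_eq_mul]
  module

theorem schouten_eq (hn : n ≠ 1) (x : M) (u w : Tan n x) : (schouten S'.conn x u w : ℝ) =
    schouten S.conn x u w - schoutenChange S.conn f x u w := by
  have hn' : (n : ℝ) - 1 ≠ 0 := sub_ne_zero.2 (by exact_mod_cast hn)
  have hr : ricci S'.conn x u w =
      ricci S.conn x u w - ((n : ℝ) - 1) * schoutenChange S.conn f x u w := by
    have h1 (i : Fin n) : (coframe x i (curv S'.conn x (frame x i) u w) : ℝ) =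
        coframe x i (curv S.conn x (frame x i) u w) +
        schoutenChange S.conn f x (frame x i) w * coframe x i u -
        schoutenChange S.conn f x u w := by
      rw [h.curv_eq, map_sub, map_add, map_smul, map_smul, isDual_frame i i, if_pos rfl]
      simp only [smul_eq_mul, mul_one]
    have h2 : ∑ i, schoutenChange S.conn f x (frame x i) w * (coframe x i u : ℝ) =
        schoutenChange S.conn f x u w := by
      conv_rhs => rw [schoutenChange, ← sum_coframe_smul u]
      simp only [map_sum, sum_apply, map_smul, smul_apply, smul_eq_mul, Finset.sum_mul,
        ← Finset.sum_sub_distrib, schoutenChange]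
      exact Finset.sum_congr rfl fun i _ => by ring
    rw [ricci, Finset.sum_congr rfl fun i _ => h1 i, Finset.sum_sub_distrib,
      Finset.sum_add_distrib, h2, ← ricci]
    simp
    ring
  rw [schouten_apply, schouten_apply, hr, mul_sub, inv_mul_cancel_left₀ hn']

theorem weyl_eq (hn : n ≠ 1) (x : M) (u v w : Tan n x) :
    weyl S'.conn x u v w = weyl S.conn x u v w := by
  rw [weyl, weyl, h.curv_eq, h.schouten_eq hn, h.schouten_eq hn]
  module

theorem schoutenForm_eq (hn : n ≠ 1) (V W : VField n M) : pair (schoutenForm S' V) W =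
    pair (schoutenForm S V) W -
      (pair (nabForm S.conn V (dform f)) W - pair (dform f) V * pair (dform f) W) := by
  ext y
  exact h.schouten_eq hn y (V y) (W y)

/-- The Cotton-York tensor changes by `½ Υ_d W_{ab}{}^d{}_c`. -/
theorem cotton_eq (hn : n ≠ 1) (x : M) (u v w : Tan n x) : cotton S'.conn x u v w =
    cotton S.conn x u v w + (1 / 2) * (differential f x (weyl S.conn x u v w) : ℝ) := by
  obtain ⟨U, rfl, hU⟩ := exists_parallel_extension S.conn u
  obtain ⟨V, rfl, hV⟩ := exists_parallel_extension S.conn v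
  obtain ⟨W, rfl, hW⟩ := exists_parallel_extension S.conn w
  have hd {U V : VField n M} : mvfderiv (𝓡 n) (pair (nabForm S.conn V (dform f)) W) x (U x) =
      mvfderiv (𝓡 n) (der V (der W f)) x (U x) -
        (differential f x (S.conn (nab S.conn V W) x (U x)) : ℝ) :=
    mvfderiv_pair_nabForm S.conn (dform f) V hW (U x)
  have hs {U V : VField n M} (hV : S.conn V x = 0) :
      (schoutenDeriv S'.conn x (U x) (V x) (W x) : ℝ) =
      mvfderiv (𝓡 n) (pair (schoutenForm S V) W) x (U x)
      - mvfderiv (𝓡 n) (der V (der W f)) x (U x)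
      + (differential f x (S.conn (nab S.conn V W) x (U x)) : ℝ)
      + ((differential f x (V x) : ℝ) * dualConn S.conn (dform f) x (U x) (W x)
      + (differential f x (W x) : ℝ) * dualConn S.conn (dform f) x (U x) (V x))
      - 2 * (differential f x (U x) : ℝ) * schouten S'.conn x (V x) (W x)
      - (differential f x (W x) : ℝ) * schouten S'.conn x (V x) (U x)
      - (differential f x (V x) : ℝ) * schouten S'.conn x (U x) (W x) := by
    rw [schoutenDeriv_apply_apply, h.schoutenForm_eq hn, mvfderiv_fsub, mvfderiv_fsub,
      mvfderiv_fmul, h V, h W, hV, hW]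
    simp only [sub_apply, add_apply, smul_apply, hd, mvfderiv_pair S.conn (dform f) hV,
      mvfderiv_pair S.conn (dform f) hW, zero_apply, map_add, map_smul, map_zero, smul_eq_mul,
      pair_apply, dform_apply]
    ring
  have hb : mvfderiv (𝓡 n) (der V (der W f)) x (U x) =
      mvfderiv (𝓡 n) (der U (der W f)) x (V x) := by
    have h1 : der (brk S.conn U V) (der W f) x = mvfderiv (𝓡 n) (der V (der W f)) x (U x) -
      mvfderiv (𝓡 n) (der U (der W f)) x (V x) := congr($(der_brk S.torsionFree U V (der W f)) x)
    rw [der_apply, brk_parallel hU hV, map_zero] at h1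
    exact (sub_eq_zero.1 h1.symm)
  have hs' {U V : VField n M} (hV : S.conn V x = 0) :
      (schoutenDeriv S.conn x (U x) (V x) (W x) : ℝ) =
      mvfderiv (𝓡 n) (pair (schoutenForm S V) W) x (U x) := by
    rw [schoutenDeriv_apply_apply, hV, hW]
    simp only [zero_apply, map_zero, sub_zero]
  rw [cotton, cotton, hs hV, hs hU, hs' hV, hs' hU, hb, weyl, curv_parallel S.torsionFree _ _ hW,
    schouten_symm S' x (V x) (U x)]
  simp only [h.schouten_eq hn, schoutenChange, map_add, map_sub, map_smul, smul_eq_mul,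
    hessian_symm S.torsionFree f x (V x) (U x)]
  ring

end IsProjChange

end ProjectiveChange

/-! ### Projective invariance of the tractor connection -/

section Invariance

variable {n : ℕ} {M : Type*} [TopologicalSpace M] [ChartedSpace (EuclideanSpace ℝ (Fin n)) M]
  [IsManifold (𝓡 n) ∞ M] [T2Space M]

theorem weyl_smul (D : AffConn n M) [CovariantDerivative.ContMDiffCovariantDerivative D ∞] {x : M}
    (u v : Tan n x) (c : ℝ) (w : Tan n x) : weyl D x u v (c • w) = c • weyl D x u v w := by
  have h : curv D x u v (c • w) = c • curv D x u v w := (curvLin D x u v).map_smul c w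
  simp only [weyl, h, map_smul, smul_eq_mul]
  module

theorem cotton_smul (D : AffConn n M) [CovariantDerivative.ContMDiffCovariantDerivative D ∞]
    {x : M} (u v : Tan n x) (c : ℝ) (w : Tan n x) :
    cotton D x u v (c • w) = c * cotton D x u v w := by
  simp only [cotton, map_smul, smul_eq_mul]
  ring

theorem BivField.IsSymm.contr {σ : BivField n M} (hσ : σ.IsSymm) {x : M} (α β : Cot n x) :
    (β (σ x α) : ℝ) = α (σ x β) := hσ x α β

theorem symProd_apply {x : M} (v w : Tan n x) (α : Cot n x) :
    symProd v w α = (α w : ℝ) • v + (α v : ℝ) • w := rfl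

namespace IsProjChange

variable {S S' : SpecialConnection n M} {f : C^∞⟮𝓡 n, M; ℝ⟯} (h : IsProjChange S.conn S'.conn f)
include h

/-- The term with the Weyl and Cotton-York tensors is projectively invariant. -/
theorem extraTerm_eq (hn : n ≠ 1) {σ σ' : BivField n M} (x : M)
    (hσ : σ' x = Real.exp (-2 * f x) • σ x) (v : Tan n x) :
    extraTerm S' σ' x v = changeSplitting (f x) (differential f x) (extraTerm S σ x v) := by
  simp only [extraTerm, changeSplitting, hσ, smul_apply, weyl_smul, cotton_smul, h.weyl_eq hn,
    h.cotton_eq hn, Prod.smul_mk, smul_zero, zero_apply, add_zero, map_zero, map_sum, map_smul,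
    ← Finset.smul_sum, ← Finset.mul_sum, Finset.sum_add_distrib, smul_eq_mul]
  congr 2
  ring

theorem bivDeriv_eq {σ : BivField n M} (hσ : σ.IsSymm) (x : M) (v : Tan n x) :
    bivDeriv S'.conn σ x v = bivDeriv S.conn σ x v + (2 * (differential f x v : ℝ)) • σ x +
      symProd v (σ x (differential f x)) := by
  ext1 a
  obtain ⟨α, rfl, hα⟩ := exists_parallel_extension (dualConn S.conn) a
  have hd : dualConn S'.conn α x v = dualConn S.conn α x v - (differential f x v : ℝ) • α x -
      (α x v : ℝ) • differential f x := by
    ext w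
    rw [h.dualConn_eq]
    simp only [sub_apply, smul_apply, smul_eq_mul]
    ring
  simp only [add_apply, smul_apply, symProd_apply]
  rw [bivDeriv_apply, bivDeriv_apply, h, hd, hσ.contr]
  simp only [contr_apply, map_sub, map_smul]
  module

/-- The tractor connection is projectively invariant. -/
theorem tractorDeriv_eq (hn : n ≠ 1) {s s' : Triple n M}
    (hs : ∀ y, s'.eval y = changeSplitting (f y) (differential f y) (s.eval y)) (x : M)
    (v : Tan n x) :
    tractorDeriv S' s' x v =
      changeSplitting (f x) (differential f x) (tractorDeriv S s x v) := by
  let g := expFun (-2) f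
  have hσ : s'.sigma = fsmul g s.sigma := by
    ext y : 1
    exact congr(($(hs y)).1)
  have hμ : s'.mu = fsmul g (s.mu + contr s.sigma (dform f)) := by
    ext y : 1
    exact congr(($(hs y)).2.1)
  have hρ : s'.rho = g * (s.rho + (ContMDiffMap.const 2 : C^∞⟮𝓡 n, M; ℝ⟯) * pair (dform f) s.mu +
      pair (dform f) (contr s.sigma (dform f))) := by
    ext y
    exact congr(($(hs y)).2.2)
  have hgx : g x = Real.exp (-2 * f x) := rfl
  have hg (v : Tan n x) : mvfderiv (𝓡 n) g x v = -2 * (differential f x v : ℝ) * g x :=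
    mvfderiv_expFun _ _ _ _
  have hP : schouten S'.conn x v = schouten S.conn x v - (dualConn S.conn (dform f) x v -
      (differential f x v : ℝ) • differential f x) := by
    ext w
    exact h.schouten_eq hn x v w
  have hσs := s.symm
  have h1 : bivDeriv S'.conn s'.sigma x v = g x • (bivDeriv S.conn s.sigma x v +
      symProd v (s.sigma x (differential f x))) := by
    have h2 : bivDeriv S'.conn s'.sigma x v =
        g x • bivDeriv S'.conn s.sigma x v + mvfderiv (𝓡 n) g x v • s.sigma x := by
      rw [hσ]
      exact conn_fsmul (homConn (dualConn S'.conn) S'.conn) g s.sigma x v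
    rw [h2, h.bivDeriv_eq hσs, hg]
    ext1 α
    simp only [add_apply, smul_apply]
    module
  have h2 : S'.conn s'.mu x v = g x • (S.conn s.mu x v + S.conn (contr s.sigma (dform f)) x v -
      (differential f x v : ℝ) • (s.mu x + s.sigma x (differential f x)) +
      (differential f x (s.mu x + s.sigma x (differential f x)) : ℝ) • v) := by
    rw [hμ, conn_fsmul, h, conn_add, hg]
    simp only [section_add_apply, contr_apply, dform_apply, add_apply]
    module
  have h3 : (differential s'.rho x v : ℝ) = g x * ((differential s.rho x v : ℝ) +
      2 * mvfderiv (𝓡 n) (pair (dform f) s.mu) x v +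
      mvfderiv (𝓡 n) (pair (dform f) (contr s.sigma (dform f))) x v -
      2 * (differential f x v : ℝ) * (s.rho x + 2 * (differential f x (s.mu x) : ℝ) +
        (differential f x (s.sigma x (differential f x)) : ℝ))) := by
    have hc : mvfderiv (𝓡 n) ⇑(ContMDiffMap.const 2 : C^∞⟮𝓡 n, M; ℝ⟯) x = 0 := mvfderiv_const _
    change mvfderiv (𝓡 n) s'.rho x v = _
    rw [hρ, mvfderiv_fmul, mvfderiv_fadd, mvfderiv_fadd, mvfderiv_fmul, hc]
    simp only [add_apply, smul_apply, smul_zero, hg, smul_eq_mul]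
    change g x * (_ + (2 * _ + 0) + _) + (s.rho x + 2 * (differential f x (s.mu x) : ℝ) +
        (differential f x (s.sigma x (differential f x)) : ℝ)) * _ = _
    change g x * ((differential s.rho x v : ℝ) + (2 * _ + 0) + _) + _ = _
    ring
  have hb : bivDeriv S.conn s.sigma x v (differential f x) =
      S.conn (contr s.sigma (dform f)) x v - s.sigma x (dualConn S.conn (dform f) x v) :=
    bivDeriv_apply S.conn s.sigma (dform f) x v
  have hbs := hσs.contr (differential f x) (dualConn S.conn (dform f) x v)
  simp only [tractorDeriv, changeSplitting, Prod.smul_mk, ← hgx]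
  refine Prod.ext ?_ (Prod.ext ?_ ?_)
  · rw [h1, hμ]
    ext1 α
    simp only [sub_apply, smul_apply, add_apply, symProd_apply, fsmul_apply, section_add_apply,
      contr_apply, dform_apply, map_add, map_smul, smul_eq_mul]
    module
  · have hρx : s'.rho x = g x * (s.rho x + 2 * (differential f x (s.mu x) : ℝ) +
        (differential f x (s.sigma x (differential f x)) : ℝ)) := by
      rw [hρ]
      rfl
    rw [h2, hρx, hP, hσ]
    simp only [sub_apply, smul_apply, symProd_apply, fsmul_apply, map_sub, map_add, map_smul]
    rw [hb]
    module
  · have h4 := dualConn_apply S.conn (dform f) s.mu x v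
    have h5 := dualConn_apply S.conn (dform f) (contr s.sigma (dform f)) x v
    rw [h3, hP, hμ]
    simp only [sub_apply, smul_apply, symProd_apply, fsmul_apply, map_sub, map_add, map_smul,
      section_add_apply, contr_apply, smul_eq_mul]
    rw [hb]
    simp only [dform_apply, contr_apply, map_sub] at h4 h5 ⊢
    linear_combination -2 * g x * h4 - g x * h5 - g x * hbs +
      2 * g x * hσs.contr (differential f x) (schouten S.conn x v)

end IsProjChange

end Invariance

/-! ### Prolongation of the equation on `σ` -/

section Prolongation

variable {n : ℕ} {M : Type*} [TopologicalSpace M] [ChartedSpace (EuclideanSpace ℝ (Fin n)) M]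
  [IsManifold (𝓡 n) ∞ M] [T2Space M]

theorem eq_of_forall_covector {x : M} {v w : Tan n x} (h : ∀ β : Cot n x, (β v : ℝ) = β w) :
    v = w := by
  rw [← sum_coframe_smul v, ← sum_coframe_smul w]
  exact Finset.sum_congr rfl fun i _ => by rw [h]

theorem sum_coframe_frame (x : M) : ∑ i, (coframe (n := n) x i (frame x i) : ℝ) = n := by
  simp [isDual_frame _ _]

theorem sum_apply_frame {x : M} (β : Cot n x) (v : Tan n x) :
    ∑ i, (coframe x i v : ℝ) * β (frame x i) = β v := by
  conv_rhs => rw [← sum_coframe_smul v, map_sum]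
  simp

theorem sum_fun_apply {ι : Type*} (a : Finset ι) (f : ι → C^∞⟮𝓡 n, M; ℝ⟯) (x : M) :
    (∑ i ∈ a, f i) x = ∑ i ∈ a, f i x := by
  rw [← ContMDiffMap.coeFnAddMonoidHom_apply, map_sum, Finset.sum_apply]
  rfl

variable (S : SpecialConnection n M)

/-- The Ricci identity for 1-forms. -/
theorem ricci_identity_form (α : OneForm n M) {x : M}
    {U V : VField n M} (hU : S.conn U x = 0) (hV : S.conn V x = 0) (w : Tan n x) :
    (dualConn S.conn (nabForm S.conn V α) x (U x) w : ℝ) -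
      dualConn S.conn (nabForm S.conn U α) x (V x) w = -α x (curv S.conn x (U x) (V x) w) := by
  obtain ⟨W, rfl, hW⟩ := exists_parallel_extension S.conn w
  have h1 : der (brk S.conn U V) (pair α W) x = mvfderiv (𝓡 n) (der V (pair α W)) x (U x) -
      mvfderiv (𝓡 n) (der U (pair α W)) x (V x) :=
    congr($(der_brk S.torsionFree U V (pair α W)) x)
  rw [der_apply, brk_parallel hU hV, map_zero] at h1
  rw [← mvfderiv_pair S.conn _ hW, ← mvfderiv_pair S.conn _ hW, mvfderiv_pair_nabForm _ _ _ hW,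
    mvfderiv_pair_nabForm _ _ _ hW, curv_parallel S.torsionFree _ _ hW, map_sub]
  linear_combination -h1

/-- The Ricci tensor as a trace over the second index of the curvature. -/
theorem ricci_eq (hn : n ≠ 1) (x : M) (u w : Tan n x) :
    ∑ i, (coframe x i (curv S.conn x u (frame x i) w) : ℝ) =
      -((n : ℝ) - 1) * schouten S.conn x u w := by
  have hn' : (n : ℝ) - 1 ≠ 0 := sub_ne_zero.2 (by exact_mod_cast hn)
  rw [schouten_apply, neg_mul, mul_inv_cancel_left₀ hn', ricci, ← Finset.sum_neg_distrib]
  exact Finset.sum_congr rfl fun i _ => by rw [curv_swap, map_neg]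

/-- The divergence `∇_a μ^a`. -/
def divergence (μ : VField n M) : C^∞⟮𝓡 n, M; ℝ⟯ :=
  ⟨fun y => ∑ i, coframe y i (S.conn μ y (frame y i)), fun x => by
    obtain ⟨P⟩ := exists_parallelFrame S x
    refine (∑ i, pair (P.θ i) (nab S.conn (P.e i) μ)).contMDiff.contMDiffAt.congr_of_eventuallyEq ?_
    filter_upwards [P.isDual] with y hy
    rw [sum_fun_apply]
    exact (hy.contraction_eq (LinearMap.mk₂ ℝ (fun u α => (α (S.conn μ y u) : ℝ))
      (by intros; simp) (by intros; simp) (by intros; simp) (by intros; simp))).symm⟩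

theorem divergence_apply (μ : VField n M) (x : M) :
    divergence S μ x = ∑ i, (coframe x i (S.conn μ x (frame x i)) : ℝ) := rfl

theorem schoutenTrace_eventually_eq (σ : BivField n M) {x : M} (P : ParallelFrame S.conn x) :
    ∀ᶠ y in 𝓝 x, ∑ i, (schouten S.conn y (frame y i) (σ y (coframe y i)) : ℝ) =
      (∑ i, pair (schoutenForm S (P.e i)) (contr σ (P.θ i))) y := by
  filter_upwards [P.isDual] with y hy
  rw [sum_fun_apply]
  exact (hy.contraction_eq (LinearMap.mk₂ ℝ (fun u α => (schouten S.conn y u (σ y α) : ℝ))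
    (by intros; simp) (by intros; simp) (by intros; simp) (by intros; simp))).symm

/-- The contraction `P_{ab} σ^{ab}`. -/
def schoutenTrace (σ : BivField n M) : C^∞⟮𝓡 n, M; ℝ⟯ :=
  ⟨fun y => ∑ i, schouten S.conn y (frame y i) (σ y (coframe y i)), fun x => by
    obtain ⟨P⟩ := exists_parallelFrame S x
    exact (ContMDiffMap.contMDiff _).contMDiffAt.congr_of_eventuallyEq
      (schoutenTrace_eventually_eq S σ P)⟩

variable {S} {σ : BivField n M} {μ : VField n M}

/-- The equation on `σ`, contracted with a 1-form. -/
theorem conn_contr (hμ : ∀ (x : M) (v : Tan n x), bivDeriv S.conn σ x v = symProd v (μ x))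
    (α : OneForm n M) (x : M) (v : Tan n x) : S.conn (contr σ α) x v =
      (α x (μ x) : ℝ) • v + (α x v : ℝ) • μ x + σ x (dualConn S.conn α x v) := by
  have h := bivDeriv_apply S.conn σ α x v
  rw [hμ, symProd_apply] at h
  rw [h]
  abel

/-- The Ricci identity for a solution `σ`. -/
theorem ricci_identity_solution (hσ : σ.IsSymm)
    (hμ : ∀ (x : M) (v : Tan n x), bivDeriv S.conn σ x v = symProd v (μ x)) (x : M)
    (u v : Tan n x) (α β : Cot n x) :
    (β (curv S.conn x u v (σ x α)) : ℝ) + α (curv S.conn x u v (σ x β)) =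
      (α (S.conn μ x u) : ℝ) * β v - (α (S.conn μ x v) : ℝ) * β u +
        (α v : ℝ) * β (S.conn μ x u) - (α u : ℝ) * β (S.conn μ x v) := by
  obtain ⟨U, rfl, hU⟩ := exists_parallel_extension S.conn u
  obtain ⟨V, rfl, hV⟩ := exists_parallel_extension S.conn v
  obtain ⟨α, rfl, hα⟩ := exists_parallel_extension (dualConn S.conn) α
  have h1 (V : VField n M) : nab S.conn V (contr σ α) =
      fsmul (pair α μ) V + fsmul (pair α V) μ + contr σ (nabForm S.conn V α) := by
    ext y : 1
    exact conn_contr hμ α y (V y)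
  have h2 {U V : VField n M} (hV : S.conn V x = 0) :
      S.conn (nab S.conn V (contr σ α)) x (U x) =
        (α x (S.conn μ x (U x)) : ℝ) • V x + (α x (V x) : ℝ) • S.conn μ x (U x) +
        σ x (dualConn S.conn (nabForm S.conn V α) x (U x)) := by
    have h3 := dualConn_apply S.conn α μ x (U x)
    rw [hα, zero_apply, zero_apply] at h3
    rw [h1, conn_add, conn_add, add_apply, add_apply, conn_fsmul, conn_fsmul, conn_contr hμ,
      mvfderiv_pair S.conn α hV, ← sub_eq_zero.1 h3.symm, hV, hα, nabForm_apply, hα]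
    simp
  have h3 := curv_apply S.torsionFree U V (contr σ α) x
  rw [brk_parallel hU hV, map_zero, sub_zero, h2 hV, h2 hU, contr_apply] at h3
  have h4 := ricci_identity_form S α hU hV (σ x β)
  have h5 := hσ.contr (dualConn S.conn (nabForm S.conn V α) x (U x)) β
  have h6 := hσ.contr (dualConn S.conn (nabForm S.conn U α) x (V x)) β
  rw [h3]
  simp only [map_sub, map_add, map_smul, smul_eq_mul]
  linear_combination h5 - h6 + h4

/-- The trace of the Ricci identity for `σ` expresses `∇μ` through `σ` and the divergence of
`μ`. -/
theorem conn_mu_eq (hn : n ≠ 1) (hσ : σ.IsSymm)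
    (hμ : ∀ (x : M) (v : Tan n x), bivDeriv S.conn σ x v = symProd v (μ x)) (x : M)
    (u : Tan n x) : (n : ℝ) • S.conn μ x u =
      ∑ i, curv S.conn x u (frame x i) (σ x (coframe x i)) -
        ((n : ℝ) - 1) • σ x (schouten S.conn x u) + divergence S μ x • u := by
  refine eq_of_forall_covector fun β => ?_
  have h := Finset.sum_congr rfl fun i (_ : i ∈ Finset.univ) =>
    ricci_identity_solution hσ hμ x u (frame x i) (coframe x i) β
  simp only [Finset.sum_add_distrib, Finset.sum_sub_distrib, sum_apply_frame, ← Finset.sum_mul] at h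
  have h1 : ∑ i, (coframe x i u : ℝ) * (β (S.conn μ x (frame x i)) : ℝ) = β (S.conn μ x u) :=
    sum_apply_frame (β.comp (S.conn μ x)) u
  rw [ricci_eq S hn, h1, sum_coframe_frame, ← divergence_apply] at h
  simp only [map_sub, map_add, map_smul, map_sum, smul_eq_mul]
  rw [hσ.contr]
  linear_combination -h

/-- The component `ρ = (∇_a μ^a + P_{ab} σ^{ab}) / n` of the tractor determined by a solution. -/
def rhoOf (S : SpecialConnection n M) (σ : BivField n M) (μ : VField n M) : C^∞⟮𝓡 n, M; ℝ⟯ :=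
  ContMDiffMap.const (n : ℝ)⁻¹ * (divergence S μ + schoutenTrace S σ)

theorem rhoOf_apply (x : M) :
    rhoOf S σ μ x = (n : ℝ)⁻¹ * (divergence S μ x + schoutenTrace S σ x) := rfl

theorem sum_weyl (hσ : σ.IsSymm) (x : M) (u : Tan n x) :
    ∑ i, weyl S.conn x u (frame x i) (σ x (coframe x i)) =
      ∑ i, curv S.conn x u (frame x i) (σ x (coframe x i)) - schoutenTrace S σ x • u +
        σ x (schouten S.conn x u) := by
  simp only [weyl, Finset.sum_add_distrib, Finset.sum_sub_distrib, ← Finset.sum_smul]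
  congr 1
  conv_rhs => rw [← sum_coframe_smul (σ x (schouten S.conn x u))]
  exact Finset.sum_congr rfl fun i _ => by rw [hσ.contr]

/-- The `μ` slot of the prolonged system. -/
theorem conn_mu_sub_eq (hn : n ≠ 1) (hn0 : n ≠ 0) (hσ : σ.IsSymm)
    (hμ : ∀ (x : M) (v : Tan n x), bivDeriv S.conn σ x v = symProd v (μ x)) (x : M)
    (u : Tan n x) :
    S.conn μ x u - rhoOf S σ μ x • u + σ x (schouten S.conn x u) =
      (n : ℝ)⁻¹ • ∑ i, weyl S.conn x u (frame x i) (σ x (coframe x i)) := by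
  have hn' : (n : ℝ) ≠ 0 := by exact_mod_cast hn0
  have h := conn_mu_eq hn hσ hμ x u
  have h1 : S.conn μ x u = (n : ℝ)⁻¹ • ((n : ℝ) • S.conn μ x u) := by
    rw [inv_smul_smul₀ hn']
  have h2 : σ x (schouten S.conn x u) = (n : ℝ)⁻¹ • ((n : ℝ) • σ x (schouten S.conn x u)) := by
    rw [inv_smul_smul₀ hn']
  rw [h1, h, sum_weyl hσ, rhoOf_apply]
  nth_rw 2 [h2]
  module

theorem curvEndDeriv_swap (V W : VField n M) (x : M) (u z : Tan n x) :
    curvEndDeriv S.conn W V x u z = -curvEndDeriv S.conn V W x u z := by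
  obtain ⟨Z, rfl, hZ⟩ := exists_parallel_extension S.conn z
  have h : curvField S.torsionFree W V Z = (-1 : ℝ) • curvField S.torsionFree V W Z := by
    ext y : 1
    change curv S.conn y (W y) (V y) (Z y) = (-1 : ℝ) • curv S.conn y (V y) (W y) (Z y)
    rw [curv_swap, neg_one_smul]
  rw [curvEndDeriv_apply S.torsionFree, curvEndDeriv_apply S.torsionFree, h, conn_smul, curv_swap]
  simp only [smul_apply]
  module

/-- The derivative of `conn_mu_eq` in a parallel frame. -/
theorem conn_nab_mu (hn : n ≠ 1) (hσ : σ.IsSymm)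
    (hμ : ∀ (x : M) (v : Tan n x), bivDeriv S.conn σ x v = symProd v (μ x)) {x : M}
    (P : ParallelFrame S.conn x) {V : VField n M} (hV : S.conn V x = 0) (u : Tan n x) :
    (n : ℝ) • S.conn (nab S.conn V μ) x u =
      ∑ i, curvEndDeriv S.conn V (P.e i) x u (σ x (coframe x i)) +
        curv S.conn x (V x) (μ x) u + curv S.conn x (V x) u (μ x) -
        ((n : ℝ) - 1) • ((schouten S.conn x (V x) (μ x) : ℝ) • u +
          (schouten S.conn x (V x) u : ℝ) • μ x + σ x (schoutenDeriv S.conn x u (V x))) +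
        mvfderiv (𝓡 n) (divergence S μ) x u • V x := by
  have h : ∀ᶠ y in 𝓝 x, ((n : ℝ) • nab S.conn V μ) y =
      (∑ i, curvField S.torsionFree V (P.e i) (contr σ (P.θ i)) -
        ((n : ℝ) - 1) • contr σ (schoutenForm S V) + fsmul (divergence S μ) V) y := by
    filter_upwards [P.isDual] with y hy
    refine (conn_mu_eq hn hσ hμ y (V y)).trans ?_
    rw [section_add_apply, section_sub_apply, sum_section_apply]
    congr 2
    exact (hy.contraction_eq (LinearMap.mk₂ ℝ (fun e α => curvLin S.conn y (V y) e (σ y α))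
      (by intros; simp only [map_add, LinearMap.add_apply])
      (by intros; simp only [map_smul, LinearMap.smul_apply])
      (by intros; simp only [map_add]) (by intros; simp only [map_smul]))).symm
  have h1 (i : Fin n) : S.conn (curvField S.torsionFree V (P.e i) (contr σ (P.θ i))) x u =
      curvEndDeriv S.conn V (P.e i) x u (σ x (coframe x i)) +
        ((coframe x i (μ x) : ℝ) • curvLin S.conn x (V x) (frame x i) u +
        (coframe x i u : ℝ) • curvLin S.conn x (V x) (frame x i) (μ x)) := by
    have h2 := curvEndDeriv_apply S.torsionFree V (P.e i) (contr σ (P.θ i)) u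
    rw [conn_contr hμ, P.dualConn_θ, ← curvLin_apply, P.e_at, contr_apply, P.θ_at, zero_apply,
      map_zero, add_zero, map_add, map_smul, map_smul] at h2
    rw [h2]
    abel
  have h2 (w z : Tan n x) : ∑ i, (coframe x i w : ℝ) • curvLin S.conn x (V x) (frame x i) z =
      curv S.conn x (V x) w z := by
    conv_rhs => rw [← curvLin_apply, ← sum_coframe_smul w, map_sum, LinearMap.sum_apply]
    exact Finset.sum_congr rfl fun i _ => by rw [map_smul, LinearMap.smul_apply]
  have h3 := congr($(conn_congr S.conn h) u)
  rw [conn_smul, conn_add, conn_sub, conn_sum, conn_smul, add_apply, sub_apply, smul_apply,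
    smul_apply, sum_apply, conn_fsmul, conn_contr hμ, hV] at h3
  have h4 := schoutenDeriv_apply S V x u
  rw [hV, zero_apply, map_zero, sub_zero] at h4
  rw [h3, h4]
  simp only [h1, Finset.sum_add_distrib, h2, zero_apply, smul_zero, zero_add, schoutenForm_apply]
  module

/-- The commutator of two derivatives of `μ`, simplified with both Bianchi identities. -/
theorem curv_mu_eq (hn : n ≠ 1) (hσ : σ.IsSymm)
    (hμ : ∀ (x : M) (v : Tan n x), bivDeriv S.conn σ x v = symProd v (μ x)) {x : M}
    (P : ParallelFrame S.conn x) {U V : VField n M} (hU : S.conn U x = 0) (hV : S.conn V x = 0) :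
    ((n : ℝ) + 3) • curv S.conn x (U x) (V x) (μ x) =
      mvfderiv (𝓡 n) (divergence S μ) x (U x) • V x -
        mvfderiv (𝓡 n) (divergence S μ) x (V x) • U x -
        ((n : ℝ) - 1) • ((schouten S.conn x (V x) (μ x) : ℝ) • U x -
          (schouten S.conn x (U x) (μ x) : ℝ) • V x +
          σ x (schoutenDeriv S.conn x (U x) (V x) - schoutenDeriv S.conn x (V x) (U x))) +
        ∑ i, curvEndDeriv S.conn V U x (frame x i) (σ x (coframe x i)) := by
  have h1 := curv_apply S.torsionFree U V μ x
  rw [brk_parallel hU hV, map_zero, sub_zero] at h1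
  have h2 := conn_nab_mu hn hσ hμ P hV (U x)
  have h3 := conn_nab_mu hn hσ hμ P hU (V x)
  have h4 := curv_bianchi S.torsionFree (U x) (V x) (μ x)
  rw [curv_swap (U x) (μ x) (V x)] at h4
  have h5 : ∑ i, curvEndDeriv S.conn V (P.e i) x (U x) (σ x (coframe x i)) -
      ∑ i, curvEndDeriv S.conn U (P.e i) x (V x) (σ x (coframe x i)) =
      ∑ i, curvEndDeriv S.conn V U x (frame x i) (σ x (coframe x i)) := by
    rw [← Finset.sum_sub_distrib]
    refine Finset.sum_congr rfl fun i _ => ?_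
    have h6 := curvEndDeriv_bianchi S.torsionFree hU hV (P.parallel i) (σ x (coframe x i))
    rw [curvEndDeriv_swap U (P.e i), P.e_at] at h6
    rw [curvEndDeriv_swap U V]
    linear_combination (norm := module) h6
  rw [curv_swap (U x) (V x) (μ x), schouten_symm S x (V x) (U x)] at h2
  rw [map_sub]
  linear_combination (norm := module) (n : ℝ) • h1 + h2 - h3 + h5 + h4

theorem cotton_eq_schoutenDeriv (x : M) (u v w : Tan n x) : 2 * cotton S.conn x u v w =
    (schoutenDeriv S.conn x u v - schoutenDeriv S.conn x v u : Cot n x) w := by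
  rw [cotton, sub_apply]
  ring

/-- The trace of `curv_mu_eq` determines the differential of the divergence of `μ`. -/
theorem mvfderiv_divergence (hn : n ≠ 1) (hσ : σ.IsSymm)
    (hμ : ∀ (x : M) (v : Tan n x), bivDeriv S.conn σ x v = symProd v (μ x)) (x : M)
    (u : Tan n x) : mvfderiv (𝓡 n) (divergence S μ) x u =
      -(2 * (n : ℝ) + 2) * schouten S.conn x u (μ x) +
        2 * ∑ i, cotton S.conn x u (frame x i) (σ x (coframe x i)) -
        ∑ i, (schoutenDeriv S.conn x (frame x i) u (σ x (coframe x i)) : ℝ) := by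
  have hn' : (n : ℝ) - 1 ≠ 0 := sub_ne_zero.2 (by exact_mod_cast hn)
  obtain ⟨U, rfl, hU⟩ := exists_parallel_extension S.conn u
  obtain ⟨P⟩ := exists_parallelFrame S x
  have h := Finset.sum_congr rfl fun i (_ : i ∈ Finset.univ) =>
    congr((coframe x i $(curv_mu_eq hn hσ hμ P hU (P.parallel i)) : ℝ))
  have hc (i : Fin n) : (coframe x i (σ x (schoutenDeriv S.conn x (U x) (frame x i) -
      schoutenDeriv S.conn x (frame x i) (U x))) : ℝ) =
      2 * cotton S.conn x (U x) (frame x i) (σ x (coframe x i)) := by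
    rw [hσ.contr, cotton_eq_schoutenDeriv]
  -- The trace of the curvature derivative over the frame index is a derivative of the Ricci tensor.
  have ht : ∑ i, ∑ j, (coframe x i (curvEndDeriv S.conn (P.e i) U x (frame x j)
      (σ x (coframe x j))) : ℝ) = ((n : ℝ) - 1) *
        ∑ j, (schoutenDeriv S.conn x (frame x j) (U x) (σ x (coframe x j)) : ℝ) := by
    rw [Finset.sum_comm, Finset.mul_sum]
    exact Finset.sum_congr rfl fun j _ => trace_curvEndDeriv S hn P hU _ _
  have hd : ∑ i, mvfderiv (𝓡 n) (divergence S μ) x (frame x i) * (coframe x i (U x) : ℝ) =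
      mvfderiv (𝓡 n) (divergence S μ) x (U x) := by
    exact (Finset.sum_congr rfl fun i _ => mul_comm _ _).trans
      (sum_apply_frame (differential (divergence S μ) x) (U x))
  have hp : ∑ i, (schouten S.conn x (frame x i) (μ x) : ℝ) * (coframe x i (U x) : ℝ) =
      schouten S.conn x (U x) (μ x) := by
    rw [schouten_symm S x (U x), ← sum_apply_frame _ (U x)]
    exact Finset.sum_congr rfl fun i _ => by rw [mul_comm, schouten_symm]
  simp only [P.e_at, map_add, map_sub (coframe x _ : Cot n x), map_smul, map_sum, smul_eq_mul, hc,
    Finset.sum_add_distrib, Finset.sum_sub_distrib, ← Finset.mul_sum, ht, ricci_eq S hn, hd, hp,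
    sum_coframe_frame] at h
  exact mul_left_cancel₀ hn' (by linear_combination -h)

theorem mvfderiv_schoutenTrace
    (hμ : ∀ (x : M) (v : Tan n x), bivDeriv S.conn σ x v = symProd v (μ x)) (x : M)
    (u : Tan n x) : mvfderiv (𝓡 n) (schoutenTrace S σ) x u =
      ∑ i, (schoutenDeriv S.conn x u (frame x i) (σ x (coframe x i)) : ℝ) +
        2 * schouten S.conn x u (μ x) := by
  obtain ⟨P⟩ := exists_parallelFrame S x
  have h1 (i : Fin n) : mvfderiv (𝓡 n) (pair (schoutenForm S (P.e i)) (contr σ (P.θ i))) x u =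
      schoutenDeriv S.conn x u (frame x i) (σ x (coframe x i)) +
        ((coframe x i (μ x) : ℝ) * schouten S.conn x u (frame x i) +
        (coframe x i u : ℝ) * schouten S.conn x (μ x) (frame x i)) := by
    have h2 := schoutenDeriv_apply_apply S (P.e i) (contr σ (P.θ i)) x u
    rw [conn_contr hμ, P.parallel, P.dualConn_θ, P.e_at, contr_apply, P.θ_at, zero_apply,
      zero_apply, map_zero, map_zero, zero_apply, add_zero, map_add, map_smul, map_smul,
      schouten_symm S x _ u, schouten_symm S x _ (μ x)] at h2
    simp only [smul_eq_mul] at h2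
    linear_combination -h2
  rw [mvfderiv_congr (schoutenTrace_eventually_eq S σ P), mvfderiv_fsum, sum_apply]
  simp only [h1, Finset.sum_add_distrib, sum_apply_frame]
  rw [schouten_symm S x (μ x)]
  ring

/-- The `ρ` slot of the prolonged system. -/
theorem mvfderiv_rhoOf (hn : n ≠ 1) (hn0 : n ≠ 0) (hσ : σ.IsSymm)
    (hμ : ∀ (x : M) (v : Tan n x), bivDeriv S.conn σ x v = symProd v (μ x)) (x : M)
    (u : Tan n x) : mvfderiv (𝓡 n) (rhoOf S σ μ) x u + 2 * (schouten S.conn x u (μ x) : ℝ) =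
      (n : ℝ)⁻¹ * (4 * ∑ i, cotton S.conn x u (frame x i) (σ x (coframe x i))) := by
  have hn' : (n : ℝ) ≠ 0 := by exact_mod_cast hn0
  have hc : mvfderiv (𝓡 n) ⇑(ContMDiffMap.const (n : ℝ)⁻¹ : C^∞⟮𝓡 n, M; ℝ⟯) x = 0 :=
    mvfderiv_const _
  have h1 : 2 * ∑ i, cotton S.conn x u (frame x i) (σ x (coframe x i)) =
      ∑ i, (schoutenDeriv S.conn x u (frame x i) (σ x (coframe x i)) : ℝ) -
      ∑ i, (schoutenDeriv S.conn x (frame x i) u (σ x (coframe x i)) : ℝ) := by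
    rw [Finset.mul_sum, ← Finset.sum_sub_distrib]
    exact Finset.sum_congr rfl fun i _ => cotton_eq_schoutenDeriv _ _ _ _
  have h2 : mvfderiv (𝓡 n) (rhoOf S σ μ) x u = (n : ℝ)⁻¹ *
      (mvfderiv (𝓡 n) (divergence S μ) x u + mvfderiv (𝓡 n) (schoutenTrace S σ) x u) := by
    rw [rhoOf, mvfderiv_fmul, hc, mvfderiv_fadd, smul_zero, add_zero]
    rfl
  rw [h2, mvfderiv_divergence hn hσ hμ, mvfderiv_schoutenTrace hμ]
  field_simp
  linear_combination -h1

end Prolongation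

/-! ### Scales and tractor sections -/

section Splittings

variable {n : ℕ} {M : Type*} [TopologicalSpace M] [ChartedSpace (EuclideanSpace ℝ (Fin n)) M]
  [IsManifold (𝓡 n) ∞ M]

/-- A shortcut for instance search, which is slow on iterated spaces of linear maps. -/
instance (x : M) : AddCommGroup (Biv n x) := ContinuousLinearMap.addCommGroup

theorem changeSplitting_zero {x : M} (s : Slots n x) : changeSplitting 0 0 s = s := by
  simp [changeSplitting]

theorem changeSplitting_slots_zero {x : M} (t : ℝ) (Υ : Cot n x) :
    changeSplitting t Υ (0 : Slots n x) = 0 := by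
  simp [changeSplitting]

theorem changeSplitting_sub_smul {x : M} (t : ℝ) (Υ : Cot n x) (c : ℝ) (s s' : Slots n x) :
    changeSplitting t Υ s - c • changeSplitting t Υ s' = changeSplitting t Υ (s - c • s') := by
  refine Prod.ext ?_ (Prod.ext ?_ ?_)
  · change Real.exp (-2 * t) • s.1 - c • Real.exp (-2 * t) • s'.1 =
      Real.exp (-2 * t) • (s.1 - c • s'.1)
    module
  · change Real.exp (-2 * t) • (s.2.1 + s.1 Υ) - c • Real.exp (-2 * t) • (s'.2.1 + s'.1 Υ) =
      Real.exp (-2 * t) • (s.2.1 - c • s'.2.1 + (s.1 Υ - c • s'.1 Υ))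
    module
  · change Real.exp (-2 * t) * (s.2.2 + 2 * (Υ s.2.1 : ℝ) + (Υ (s.1 Υ) : ℝ)) -
        c * (Real.exp (-2 * t) * (s'.2.2 + 2 * (Υ s'.2.1 : ℝ) + (Υ (s'.1 Υ) : ℝ))) =
      Real.exp (-2 * t) * (s.2.2 - c * s'.2.2 + 2 * (Υ (s.2.1 - c • s'.2.1) : ℝ) +
        (Υ (s.1 Υ - c • s'.1 Υ) : ℝ))
    simp only [map_sub, map_smul, smul_eq_mul]
    ring

theorem slots_sub_smul_eq_zero {x : M} {s s' : Slots n x} {c : ℝ} :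
    s - c • s' = 0 ↔ s.1 = c • s'.1 ∧ s.2.1 = c • s'.2.1 ∧ s.2.2 = c * s'.2.2 := by
  rw [Prod.ext_iff, Prod.ext_iff]
  exact and_congr sub_eq_zero (and_congr sub_eq_zero sub_eq_zero)

/-- Changes of splitting compose; the symmetry of the tensor accounts for the cross terms. -/
theorem changeSplitting_changeSplitting {x : M} (t t' : ℝ) (Υ Υ' : Cot n x) (s : Slots n x)
    (hs : (Υ' (s.1 Υ) : ℝ) = Υ (s.1 Υ')) :
    changeSplitting t' Υ' (changeSplitting t Υ s) = changeSplitting (t + t') (Υ + Υ') s := by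
  have he : Real.exp (-2 * (t + t')) = Real.exp (-2 * t') * Real.exp (-2 * t) := by
    rw [← Real.exp_add]
    ring_nf
  simp only [changeSplitting, he, mul_smul]
  congr 1
  simp only [Prod.smul_mk, smul_apply, map_smul, map_add, add_apply, smul_eq_mul]
  refine Prod.ext rfl (Prod.ext ?_ ?_)
  · module
  · simp only
    linear_combination Real.exp (-2 * t) * hs

theorem VolRescaling.trans {S₁ S₂ S₃ : SpecialConnection n M} {f g : C^∞⟮𝓡 n, M; ℝ⟯}
    (hf : VolRescaling S₁ S₂ f) (hg : VolRescaling S₂ S₃ g) : VolRescaling S₁ S₃ (f + g) := by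
  intro x
  rw [hg, hf, smul_smul, ← Real.exp_add, ContMDiffMap.coe_add, Pi.add_apply]
  ring_nf

theorem VolRescaling.symm {S₁ S₂ : SpecialConnection n M} {f : C^∞⟮𝓡 n, M; ℝ⟯}
    (hf : VolRescaling S₁ S₂ f) : VolRescaling S₂ S₁ (-f) := by
  intro x
  rw [hf, smul_smul, ← Real.exp_add, ContMDiffMap.coe_neg, Pi.neg_apply, mul_neg, neg_add_cancel,
    Real.exp_zero, one_smul]

theorem VolRescaling.refl (S : SpecialConnection n M) : VolRescaling S S 0 := by
  intro x
  simp

theorem VolRescaling.unique {S₁ S₂ : SpecialConnection n M} {f g : C^∞⟮𝓡 n, M; ℝ⟯}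
    (hf : VolRescaling S₁ S₂ f) (hg : VolRescaling S₁ S₂ g) : f = g := by
  ext x
  have h := smul_left_injective ℝ (S₁.vol_ne_zero x) ((hf x).symm.trans (hg x))
  have hn : (n : ℝ) + 1 ≠ 0 := by positivity
  exact mul_left_cancel₀ hn (Real.exp_injective h)

theorem Scale.exists_volRescaling {D : SpecialConnection n M} (D₁ D₂ : Scale D) :
    ∃ f, VolRescaling D₁.1 D₂.1 f := by
  obtain ⟨f₁, h₁⟩ := D₁.2.2
  obtain ⟨f₂, h₂⟩ := D₂.2.2
  exact ⟨_, h₁.symm.trans h₂⟩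

theorem Triple.ext_eval {s s' : Triple n M} (h : ∀ x, s.eval x = s'.eval x) : s = s' := by
  obtain ⟨σ, hσ, μ, ρ⟩ := s
  obtain ⟨σ', hσ', μ', ρ'⟩ := s'
  obtain rfl : σ = σ' := by
    ext x : 1
    exact congr(($(h x)).1)
  obtain rfl : μ = μ' := by
    ext x : 1
    exact congr(($(h x)).2.1)
  obtain rfl : ρ = ρ' := by
    ext x
    exact congr(($(h x)).2.2)
  rfl

/-- A tractor section is determined by its components in one scale. -/
theorem TractorSection.ext_comp {D : SpecialConnection n M} {T T' : TractorSection D} (D' : Scale D)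
    (h : T.comp D' = T'.comp D') : T = T' := by
  obtain ⟨c, hc⟩ := T
  obtain ⟨c', hc'⟩ := T'
  congr 1
  funext D₂
  obtain ⟨f, hf⟩ := D'.exists_volRescaling D₂
  refine Triple.ext_eval fun x => ?_
  rw [hc D' D₂ f hf, hc' D' D₂ f hf]
  exact congr(changeSplitting _ _ (($h).eval x))

variable [T2Space M]

/-- The `σ` slot of the tractor connection determines `μ`. -/
theorem symProd_right_injective {x : M} {w w' : Tan n x}
    (h : ∀ v : Tan n x, symProd v w = symProd v w') : w = w' := by
  refine eq_of_forall_covector fun α => ?_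
  -- Taking `v = w - w'` and contracting twice with `α` gives `2 (α (w - w'))² = 0`.
  have h1 : (α (symProd (w - w') w α) : ℝ) = α (symProd (w - w') w' α) := by rw [h]
  simp only [symProd_apply, map_add, map_smul, map_sub, smul_eq_mul] at h1
  have h2 : ((α w : ℝ) - α w') ^ 2 = 0 := by linear_combination (1 / 2) * h1
  exact sub_eq_zero.1 (pow_eq_zero_iff two_ne_zero |>.1 h2)

theorem differential_add (f g : C^∞⟮𝓡 n, M; ℝ⟯) (x : M) :
    (differential ⇑(f + g) x : Cot n x) = differential f x + differential g x := mvfderiv_fadd f g x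

theorem differential_zero (x : M) :
    (differential ⇑(0 : C^∞⟮𝓡 n, M; ℝ⟯) x : Cot n x) = 0 := mvfderiv_const (0 : ℝ)

/-- The triple `s` in the scale whose volume form is rescaled by `e^{(n+1)f}`. -/
def Triple.rescale (s : Triple n M) (f : C^∞⟮𝓡 n, M; ℝ⟯) : Triple n M where
  sigma := fsmul (expFun (-2) f) s.sigma
  symm x α β := by
    simp only [fsmul_apply, smul_apply, map_smul, s.symm x α β]
  mu := fsmul (expFun (-2) f) (s.mu + contr s.sigma (dform f))
  rho := expFun (-2) f * (s.rho + (ContMDiffMap.const 2 : C^∞⟮𝓡 n, M; ℝ⟯) * pair (dform f) s.mu +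
    pair (dform f) (contr s.sigma (dform f)))

theorem Triple.eval_rescale (s : Triple n M) (f : C^∞⟮𝓡 n, M; ℝ⟯) (x : M) :
    (s.rescale f).eval x = changeSplitting (f x) (differential f x) (s.eval x) := rfl

/-- The tractor section with prescribed components in one scale. -/
def TractorSection.ofTriple {D : SpecialConnection n M} (D' : Scale D) (s : Triple n M) :
    TractorSection D where
  comp D₂ := s.rescale (D'.exists_volRescaling D₂).choose
  change D₁ D₂ f hf x := by
    rw [Triple.eval_rescale, Triple.eval_rescale, changeSplitting_changeSplitting _ _ _ _ _
      (s.symm x _ _), ← differential_add, VolRescaling.unique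
      (D'.exists_volRescaling D₂).choose_spec ((D'.exists_volRescaling D₁).choose_spec.trans hf)]
    rfl

theorem TractorSection.ofTriple_comp {D : SpecialConnection n M} (D' : Scale D) (s : Triple n M) :
    (ofTriple D' s).comp D' = s := by
  refine Triple.ext_eval fun x => ?_
  change (s.rescale _).eval x = _
  rw [VolRescaling.unique (D'.exists_volRescaling D').choose_spec (.refl _), Triple.eval_rescale,
    differential_zero]
  exact changeSplitting_zero _

/-- Both the tractor derivative and the curvature term are projectively invariant. -/
theorem TractorSection.invariance (hn : n ≠ 1) {D : SpecialConnection n M} (T : TractorSection D)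
    {D₁ D₂ : Scale D} {f : C^∞⟮𝓡 n, M; ℝ⟯} (hf : VolRescaling D₁.1 D₂.1 f) (x : M) (v : Tan n x) :
    tractorDeriv D₂.1 (T.comp D₂) x v =
        changeSplitting (f x) (differential f x) (tractorDeriv D₁.1 (T.comp D₁) x v) ∧
      extraTerm D₂.1 (T.comp D₂).sigma x v =
        changeSplitting (f x) (differential f x) (extraTerm D₁.1 (T.comp D₁).sigma x v) := by
  have h := isProjChange_of_volRescaling D₁.2.1 D₂.2.1 hf
  have hT := T.change D₁ D₂ f hf
  exact ⟨h.tractorDeriv_eq hn hT x v, h.extraTerm_eq hn x congr(($(hT x)).1) v⟩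

/-- The prolonged equation holds in all scales if it holds in one. -/
theorem TractorSection.prolonged_of_scale (hn : n ≠ 1) {D : SpecialConnection n M}
    (T : TractorSection D) (D' : Scale D) (h : ∀ (x : M) (v : Tan n x),
      tractorDeriv D'.1 (T.comp D') x v -
        (1 / (n : ℝ)) • extraTerm D'.1 (T.comp D').sigma x v = 0)
    (D₁ : Scale D) (x : M) (v : Tan n x) : tractorDeriv D₁.1 (T.comp D₁) x v -
        (1 / (n : ℝ)) • extraTerm D₁.1 (T.comp D₁).sigma x v = 0 := by
  obtain ⟨f, hf⟩ := D'.exists_volRescaling D₁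
  obtain ⟨h1, h2⟩ := T.invariance hn hf x v
  rw [h1, h2, changeSplitting_sub_smul, h, changeSplitting_slots_zero]

/-- The tractor determined by a solution satisfies the prolonged equation. -/
theorem prolonged_of_solution (hn : n ≠ 1) (hn0 : n ≠ 0) (S : SpecialConnection n M)
    {σ : BivField n M} (hσ : σ.IsSymm) {μ : VField n M}
    (hμ : ∀ (x : M) (v : Tan n x), bivDeriv S.conn σ x v = symProd v (μ x)) (x : M) (v : Tan n x) :
    tractorDeriv S ⟨σ, hσ, μ, rhoOf S σ μ⟩ x v - (1 / (n : ℝ)) • extraTerm S σ x v = 0 := by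
  rw [one_div]
  refine slots_sub_smul_eq_zero.2 ⟨?_, ?_, ?_⟩
  · change bivDeriv S.conn σ x v - symProd v (μ x) = (n : ℝ)⁻¹ • (0 : Biv n x)
    rw [hμ, sub_self, smul_zero]
  · exact conn_mu_sub_eq hn hn0 hσ hμ x v
  · exact mvfderiv_rhoOf hn hn0 hσ hμ x v

/-- A solution `(σ, μ, ρ)` of the prolonged equation is determined by `σ`. -/
theorem triple_eq_of_sigma_eq (hn0 : n ≠ 0) (S : SpecialConnection n M) {s s' : Triple n M}
    (hs : ∀ (x : M) (v : Tan n x),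
      tractorDeriv S s x v - (1 / (n : ℝ)) • extraTerm S s.sigma x v = 0)
    (hs' : ∀ (x : M) (v : Tan n x),
      tractorDeriv S s' x v - (1 / (n : ℝ)) • extraTerm S s'.sigma x v = 0)
    (h : s.sigma = s'.sigma) : s = s' := by
  obtain ⟨σ, hσ, μ, ρ⟩ := s
  obtain ⟨σ', hσ', μ', ρ'⟩ := s'
  obtain rfl : σ = σ' := h
  have he (x : M) (v : Tan n x) := slots_sub_smul_eq_zero.1 (hs x v)
  have he' (x : M) (v : Tan n x) := slots_sub_smul_eq_zero.1 (hs' x v)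
  obtain rfl : μ = μ' := by
    ext x : 1
    exact symProd_right_injective fun v =>
      (sub_right_inj (a := bivDeriv S.conn σ x v)).1 ((he x v).1.trans (he' x v).1.symm)
  obtain rfl : ρ = ρ' := by
    ext x
    obtain ⟨i⟩ : Nonempty (Fin n) := Fin.pos_iff_nonempty.1 (Nat.pos_of_ne_zero hn0)
    have h2 : S.conn μ x (frame x i) - ρ x • frame x i + σ x (schouten S.conn x (frame x i)) =
        S.conn μ x (frame x i) - ρ' x • frame x i + σ x (schouten S.conn x (frame x i)) :=
      (he x (frame x i)).2.1.trans (he' x (frame x i)).2.1.symm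
    exact smul_left_injective ℝ ((frame x).ne_zero i) (sub_right_inj.1 (add_left_inj _ |>.1 h2))
  rfl

end Splittings

end ProjTractor

end

theorem mainTheorem4 (n : ℕ) (hn : 2 ≤ n) (M : Type*) [TopologicalSpace M] [T2Space M]
    [ChartedSpace (EuclideanSpace ℝ (Fin n)) M] [IsManifold (𝓡 n) ∞ M]
    (D : ProjTractor.SpecialConnection n M) :
    (∀ (T : ProjTractor.TractorSection D) (D₁ D₂ : ProjTractor.Scale D) (f : C^∞⟮𝓡 n, M; ℝ⟯),
      ProjTractor.VolRescaling D₁.1 D₂.1 f → ∀ (x : M) (v : ProjTractor.Tan n x),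
        ProjTractor.tractorDeriv D₂.1 (T.comp D₂) x v =
          ProjTractor.changeSplitting (f x) (ProjTractor.differential f x)
            (ProjTractor.tractorDeriv D₁.1 (T.comp D₁) x v) ∧
        ProjTractor.extraTerm D₂.1 (T.comp D₂).sigma x v =
          ProjTractor.changeSplitting (f x) (ProjTractor.differential f x)
            (ProjTractor.extraTerm D₁.1 (T.comp D₁).sigma x v)) ∧
    (∀ D' : ProjTractor.Scale D,
      Set.BijOn (fun T : ProjTractor.TractorSection D => (T.comp D').sigma)
        {T | ∀ (D₁ : ProjTractor.Scale D) (x : M) (v : ProjTractor.Tan n x),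
          ProjTractor.tractorDeriv D₁.1 (T.comp D₁) x v -
            (1 / (n : ℝ)) • ProjTractor.extraTerm D₁.1 (T.comp D₁).sigma x v = 0}
        {σ | σ.IsSymm ∧ ProjTractor.IsKeySolution D'.1 σ}) := by
  have hn1 : n ≠ 1 := by lia
  have hn0 : n ≠ 0 := by lia
  refine ⟨fun T D₁ D₂ f hf x v => T.invariance hn1 hf x v, fun D' => ⟨?_, ?_, ?_⟩⟩
  · intro T hT
    refine ⟨(T.comp D').symm, (T.comp D').mu, fun x v => sub_eq_zero.1 ?_⟩
    exact (ProjTractor.slots_sub_smul_eq_zero.1 (hT D' x v)).1.trans (smul_zero _)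
  · intro T hT T' hT' h
    exact ProjTractor.TractorSection.ext_comp D'
      (ProjTractor.triple_eq_of_sigma_eq hn0 D'.1 (hT D') (hT' D') h)
  · rintro σ ⟨hσ, μ, hμ⟩
    let T := ProjTractor.TractorSection.ofTriple D' ⟨σ, hσ, μ, ProjTractor.rhoOf D'.1 σ μ⟩
    have hT : T.comp D' = _ := ProjTractor.TractorSection.ofTriple_comp _ _
    refine ⟨T, T.prolonged_of_scale hn1 D' ?_, congr(($hT).sigma)⟩
    rw [hT]
    exact ProjTractor.prolonged_of_solution hn1 hn0 D'.1 hσ hμ
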